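/- For a finite Borel measure $\mu$ on $\mathbb{R}$ write $\widehat{\mu}(\xi)=\int e^{-2\pi i x\xi}\,d\mu(x)$, and for $A\subseteq\mathbb{R}$ let $\dim_H(A)$ be its Hausdorff dimension and let its Fourier dimension $\dim_F(A)$ be the supremum of all $s\in[0,1]$ such that $\sup_{\xi\in\mathbb{R}}|\widehat{\mu}(\xi)|^2|\xi|^s<\infty$ for some non-zero finite Borel measure $\mu$ on $\mathbb{R}$ with compact support contained in $A$. Let $Y, Z\subseteq\mathbb{R}$ be compact sets such that $Z$ is non-empty, $Y$ contains a non-zero point and $\dim_F(Y)+\dim_H(Z)>0$. Then for every $\alpha\in[0,1]$ with $\dim_F(Y)+\dim_H(Z)>1-\alpha$ there exists a compact set $R\subseteq(0,\infty)$ such that $\dim_H(R)=\dim_F(R)=\alpha$ and the set $RY+Z=\{ry+z : r\in R,\ y\in Y,\ z\in Z\}$ has positive Lebesgue measure. -/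

import Mathlib

open MeasureTheory Set
open scoped ENNReal NNReal Pointwise

/-- The Fourier transform `μ̂(ξ) = ∫ e^{-2πixξ} dμ(x)` of a (finite Borel) measure on `ℝ`. -/
noncomputable def measureFourier (μ : Measure ℝ) (ξ : ℝ) : ℂ :=
  ∫ x, Complex.exp (-2 * Real.pi * Complex.I * x * ξ) ∂μ

/-- `𝓜(A)`: the non-zero finite Borel measures on `ℝ` with compact support contained in `A`. -/
def compactlySupportedMeasures (A : Set ℝ) : Set (Measure ℝ) :=
  {μ | IsFiniteMeasure μ ∧ μ ≠ 0 ∧ IsCompact μ.support ∧ μ.support ⊆ A}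

/-- `sup_ξ |μ̂(ξ)|² |ξ|^s < ∞`. -/
def HasFourierDecay (μ : Measure ℝ) (s : ℝ) : Prop :=
  BddAbove (range fun ξ : ℝ => ‖measureFourier μ ξ‖ ^ 2 * |ξ| ^ s)

/-- The Fourier dimension of `A ⊆ ℝ`: the supremum of the `s ∈ [0, 1]` such that
`sup_ξ |μ̂(ξ)|² |ξ|^s < ∞` for some `μ ∈ 𝓜(A)`. It is `0` for the empty set. -/
noncomputable def fourierDim (A : Set ℝ) : ℝ≥0∞ :=
  ⨆ (s : ℝ≥0) (_ : s ≤ 1 ∧ ∃ μ ∈ compactlySupportedMeasures A, HasFourierDecay μ s), (s : ℝ≥0∞)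

/-!
Let `C ⊆ [0, 2]` be a Salem set of dimension `α`, and let `R = a + b * C` for a generic
`(a, b) ∈ [1, 2]²`. Since affine maps do not lower the Fourier dimension or raise the Hausdorff
dimension, `α ≤ fourierDim R ≤ dimH R ≤ α`.

*Positive measure.* Let `ρ`, `μ`, `ν` be finite compactly supported measures on `C`, `Y \ {0}`, `Z`
whose correlation integrals at scale `r` are `O(r ^ sᵢ)` with `∑ sᵢ > 1`, and push `ρ × μ × ν`
forward under `(c, y, z) ↦ (a + b * c) * y + z`. The difference of the images of two points is
affine in `(a, b)` and, since `y` stays away from `0`, its coefficients control the distance of the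
points. The expected correlation integral of the image at scale `r` is therefore at most `r` times a
multiple of the `1`-energy of `ρ × μ × ν`, which is finite. By Fatou's lemma, for almost every
`(a, b)` the correlation integral of the image is `O(r)` along a sequence of scales `r → 0`, and by
the Cauchy–Schwarz inequality the support of such a measure has positive Lebesgue measure.

*Measures with correlation decay.* Fourier decay of exponent `s < 1` gives correlation decay of
exponent `s`, by testing against a Gaussian. If the Hausdorff content of a compact `A ⊆ ℝ` is
positive, then the Stieltjes measure of `x ↦ content (A ∩ Iic x)` is a Frostman measure on `A`.

*Salem sets.* Starting from a measure with rapidly decaying Fourier transform, multiply repeatedly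
by the average, over the primes `p ≤ M`, of tents of width `η / p` around `ℤ / p`, where
`η = M ^ (1 - 2 / α)`. The `k`-th Fourier coefficient of this factor only sees the primes dividing
`k`, and these are few, so for large `M` the factor barely changes a Fourier transform of decay
`< α / 2`. The limit measure lives on points which are `η / p`-close to `ℤ / p` for some `p ≤ M`,
for infinitely many `M`, and these intervals cover so economically that the dimension is at most
`α`.
-/

open Filter Topology Metric
open scoped FourierTransform

/-- The correlation integral of `μ` at scale `r`: the `μ × μ`-mass of the pairs at distance at most
`r`. -/
noncomputable def correlationIntegral {X : Type*} [PseudoMetricSpace X] [MeasurableSpace X]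
    (μ : Measure X) (r : ℝ) : ℝ≥0∞ :=
  (μ.prod μ) {p | dist p.1 p.2 ≤ r}

/-- The correlation integral of `μ` is `O(r ^ s)`; the supremum of such `s` is the (lower)
correlation dimension of `μ`. -/
def HasCorrelationDecay {X : Type*} [PseudoMetricSpace X] [MeasurableSpace X]
    (μ : Measure X) (s : ℝ) : Prop :=
  ∃ C : ℝ≥0, ∀ r : ℝ, 0 < r → correlationIntegral μ r ≤ C * ENNReal.ofReal (r ^ s)

/-- The Riesz `t`-energy `∬ d(x, y) ^ (-t) dμ(x) dμ(y)`, whose integrand is `∞` on the diagonal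
when `t > 0`. -/
noncomputable def rieszEnergy {X : Type*} [PseudoEMetricSpace X] [MeasurableSpace X]
    (t : ℝ) (μ : Measure X) : ℝ≥0∞ :=
  ∫⁻ p, edist p.1 p.2 ^ (-t) ∂μ.prod μ

theorem rpow_neg_le_one_add_tsum_dyadic (x : ℝ≥0∞) {t : ℝ} (ht : 0 < t) :
    x ^ (-t) ≤ 1 + ∑' k : ℕ, {y : ℝ≥0∞ | y ≤ 2⁻¹ ^ k}.indicator (fun _ => (2 ^ t) ^ (k + 1)) x := by
  rcases le_or_gt 1 x with h1 | h1
  · exact le_add_right (by simpa using ENNReal.rpow_le_one_of_one_le_of_neg h1 (neg_lt_zero.2 ht))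
  by_cases hx : ∀ k : ℕ, x ≤ 2⁻¹ ^ k
  · have htop : ∑' k : ℕ,
        {y : ℝ≥0∞ | y ≤ 2⁻¹ ^ k}.indicator (fun _ => (2 ^ t) ^ (k + 1)) x = ∞ := by
      refine top_unique ?_
      rw [← ENNReal.tsum_const_eq_top_of_ne_zero (α := ℕ) one_ne_zero]
      refine ENNReal.tsum_le_tsum fun k => ?_
      rw [indicator_of_mem (show x ∈ {y : ℝ≥0∞ | y ≤ 2⁻¹ ^ k} from hx k)]
      exact one_le_pow₀ (ENNReal.one_le_rpow one_le_two ht)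
    simp [htop]
  · obtain ⟨k, hk, hk'⟩ : ∃ k : ℕ, x ≤ 2⁻¹ ^ k ∧ 2⁻¹ ^ (k + 1) < x := by
      by_contra! h
      exact hx fun k => Nat.rec (by simpa using h1.le) h k
    refine le_add_left (le_trans ?_ (ENNReal.le_tsum k))
    rw [indicator_of_mem (show x ∈ {y : ℝ≥0∞ | y ≤ 2⁻¹ ^ k} from hk), ENNReal.rpow_neg,
      ← ENNReal.inv_rpow, ← ENNReal.rpow_natCast, ← ENNReal.rpow_mul, mul_comm, ENNReal.rpow_mul,
      ENNReal.rpow_natCast]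
    gcongr
    rw [← inv_inv ((2 : ℝ≥0∞) ^ (k + 1)), ENNReal.inv_le_inv, ENNReal.inv_pow]
    exact hk'.le

section Correlation

variable {X : Type*} [PseudoMetricSpace X] [MeasurableSpace X] [OpensMeasurableSpace X]
  [SecondCountableTopology X]

theorem measurableSet_dist_le (r : ℝ) : MeasurableSet {p : X × X | dist p.1 p.2 ≤ r} :=
  measurableSet_le measurable_dist measurable_const

theorem correlationIntegral_map {Ω : Type*} [MeasurableSpace Ω] {μ : Measure Ω} [SFinite μ]
    {f : Ω → X} (hf : Measurable f) (r : ℝ) :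
    correlationIntegral (μ.map f) r = (μ.prod μ) {p | dist (f p.1) (f p.2) ≤ r} := by
  rw [correlationIntegral, Measure.map_prod_map _ _ hf hf,
    Measure.map_apply (by fun_prop) (measurableSet_dist_le r)]
  rfl

section Prod

variable {Y : Type*} [PseudoMetricSpace Y] [MeasurableSpace Y] [OpensMeasurableSpace Y]
  [SecondCountableTopology Y] {μ : Measure X} {ν : Measure Y} [SFinite μ] [SFinite ν]

theorem correlationIntegral_prod (r : ℝ) :
    correlationIntegral (μ.prod ν) r = correlationIntegral μ r * correlationIntegral ν r := by
  have hX : MeasurableSet {p : X × X | dist p.1 p.2 ≤ r} := measurableSet_dist_le r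
  have hY : MeasurableSet {p : Y × Y | dist p.1 p.2 ≤ r} := measurableSet_dist_le r
  simp only [correlationIntegral]
  rw [Measure.prod_apply (measurableSet_dist_le r), Measure.prod_apply hX, Measure.prod_apply hY,
    ← lintegral_prod_mul (measurable_measure_prodMk_left hX).aemeasurable
      (measurable_measure_prodMk_left hY).aemeasurable]
  refine lintegral_congr fun p => ?_
  rw [← Measure.prod_prod]
  congr 1
  ext q
  simp only [mem_preimage, mem_ofPred_eq, mem_prod, Prod.dist_eq, max_le_iff]

theorem HasCorrelationDecay.prod {s t : ℝ} (hμ : HasCorrelationDecay μ s)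
    (hν : HasCorrelationDecay ν t) : HasCorrelationDecay (μ.prod ν) (s + t) := by
  obtain ⟨C, hC⟩ := hμ
  obtain ⟨D, hD⟩ := hν
  refine ⟨C * D, fun r hr => ?_⟩
  rw [correlationIntegral_prod, Real.rpow_add hr, ENNReal.ofReal_mul (by positivity),
    ENNReal.coe_mul, mul_mul_mul_comm]
  exact mul_le_mul' (hC r hr) (hD r hr)

end Prod

theorem rieszEnergy_le_add_tsum (μ : Measure X) {t : ℝ} (ht : 0 < t) :
    rieszEnergy t μ ≤
      (μ.prod μ) univ + ∑' k : ℕ, (2 ^ t) ^ (k + 1) * correlationIntegral μ (2⁻¹ ^ k) := by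
  have hm (k : ℕ) : MeasurableSet {y : ℝ≥0∞ | y ≤ 2⁻¹ ^ k} := measurableSet_Iic
  have hdist (k : ℕ) :
      (fun p : X × X => edist p.1 p.2) ⁻¹' {y | y ≤ 2⁻¹ ^ k} = {p | dist p.1 p.2 ≤ 2⁻¹ ^ k} := by
    have : (2⁻¹ : ℝ≥0∞) ^ k = ENNReal.ofReal (2⁻¹ ^ k) := by
      rw [ENNReal.ofReal_pow (by positivity), ENNReal.ofReal_inv_of_pos two_pos,
        ENNReal.ofReal_ofNat]
    ext p
    exact this ▸ edist_le_ofReal (by positivity)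
  calc rieszEnergy t μ
      ≤ ∫⁻ p, (1 + ∑' k : ℕ, {y : ℝ≥0∞ | y ≤ 2⁻¹ ^ k}.indicator (fun _ => (2 ^ t) ^ (k + 1))
          (edist p.1 p.2)) ∂μ.prod μ :=
        lintegral_mono fun p => rpow_neg_le_one_add_tsum_dyadic _ ht
    _ = (μ.prod μ) univ + ∑' k : ℕ, (2 ^ t) ^ (k + 1) * correlationIntegral μ (2⁻¹ ^ k) := by
        rw [lintegral_add_left measurable_const, lintegral_one, lintegral_tsum]
        · congr! 3 with k
          rw [correlationIntegral, ← hdist k]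
          exact lintegral_indicator_const (measurable_edist (hm k)) _
        · exact fun k =>
            ((measurable_const.indicator (hm k)).comp measurable_edist).aemeasurable

theorem HasCorrelationDecay.rieszEnergy_lt_top {μ : Measure X} [IsFiniteMeasure μ] {s t : ℝ}
    (hμ : HasCorrelationDecay μ s) (ht : 0 < t) (hts : t < s) : rieszEnergy t μ < ∞ := by
  obtain ⟨C, hC⟩ := hμ
  have hratio : (2 : ℝ) ^ t * 2⁻¹ ^ s < 1 := by
    rw [Real.inv_rpow two_pos.le, ← Real.rpow_neg two_pos.le, ← Real.rpow_add two_pos]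
    exact Real.rpow_lt_one_of_one_lt_of_neg one_lt_two (by linarith)
  have hterm (k : ℕ) : (2 ^ t) ^ (k + 1) * correlationIntegral μ (2⁻¹ ^ k) ≤
      2 ^ t * C * ENNReal.ofReal (2 ^ t * 2⁻¹ ^ s) ^ k := by
    have hpow : ((2⁻¹ : ℝ) ^ k) ^ s = (2⁻¹ ^ s) ^ k := by
      rw [← Real.rpow_natCast_mul (by norm_num), ← Real.rpow_mul_natCast (by norm_num), mul_comm]
    calc (2 ^ t) ^ (k + 1) * correlationIntegral μ (2⁻¹ ^ k)
        ≤ (2 ^ t) ^ (k + 1) * (C * ENNReal.ofReal ((2⁻¹ ^ k) ^ s)) := by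
          gcongr
          exact hC _ (by positivity)
      _ = 2 ^ t * C * ENNReal.ofReal (2 ^ t * 2⁻¹ ^ s) ^ k := by
          rw [hpow, ENNReal.ofReal_pow (by positivity), ENNReal.ofReal_mul (by positivity),
            ← ENNReal.ofReal_rpow_of_pos two_pos, ENNReal.ofReal_ofNat]
          ring
  refine (rieszEnergy_le_add_tsum μ ht).trans_lt (ENNReal.add_lt_top.2 ⟨measure_lt_top _ _, ?_⟩)
  refine (ENNReal.tsum_le_tsum hterm).trans_lt ?_
  rw [ENNReal.tsum_mul_left, ENNReal.tsum_geometric]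
  refine ENNReal.mul_lt_top (ENNReal.mul_lt_top ?_ ENNReal.coe_lt_top) ?_
  · exact ENNReal.rpow_lt_top_of_nonneg ht.le ENNReal.ofNat_ne_top
  · exact ENNReal.inv_lt_top.2 (tsub_pos_of_lt (ENNReal.ofReal_lt_one.2 hratio))

end Correlation

theorem measure_le_mul_ediam_rpow {X : Type*} [PseudoEMetricSpace X] [MeasurableSpace X]
    [OpensMeasurableSpace X] {μ : Measure X} {t : ℝ} {c : ℝ≥0∞} {U : Set X} {x : X}
    (ht : 0 ≤ t) (hx : x ∈ U) (hU : ediam U ≠ ∞) (hc : c ≠ ∞)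
    (hpot : ∫⁻ y, edist x y ^ (-t) ∂μ ≤ c) : μ U ≤ c * ediam U ^ t := by
  have hμU : ediam U ^ (-t) * μ U ≤ c :=
    calc ediam U ^ (-t) * μ U ≤ ediam U ^ (-t) * μ {y | ediam U ^ (-t) ≤ edist x y ^ (-t)} := by
          refine mul_le_mul_right (measure_mono fun y hy => ?_) _
          have hxy : edist x y ≤ ediam U := edist_le_ediam_of_mem hx hy
          simp only [mem_ofPred_eq, ENNReal.rpow_neg]
          gcongr
      _ ≤ ∫⁻ y, edist x y ^ (-t) ∂μ := mul_meas_ge_le_lintegral (by fun_prop) _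
      _ ≤ c := hpot
  rwa [mul_comm, ENNReal.rpow_neg, ← div_eq_mul_inv, ENNReal.div_le_iff_le_mul (Or.inr hc)
    (Or.inl (ENNReal.rpow_ne_top_of_nonneg ht hU))] at hμU

theorem exists_measure_le_natCast_ne_zero {Ω : Type*} [MeasurableSpace Ω] {μ : Measure Ω}
    (hμ : μ ≠ 0) {φ : Ω → ℝ≥0∞} (hφ : ∀ᵐ x ∂μ, φ x < ∞) : ∃ N : ℕ, μ {x | φ x ≤ N} ≠ 0 := by
  by_contra! hnull
  have : (ae μ).NeBot := ae_neBot.2 hμ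
  have hgt : ∀ᵐ x ∂μ, ∀ N : ℕ, ¬ φ x ≤ N := ae_all_iff.2 fun N => by simpa [ae_iff] using hnull N
  obtain ⟨x, hlt, hxgt⟩ := (hφ.and hgt).exists
  obtain ⟨N, hN⟩ := ENNReal.exists_nat_gt hlt.ne
  exact hxgt N hN.le

theorem le_dimH_of_rieszEnergy_lt_top {X : Type*} [EMetricSpace X] [MeasurableSpace X]
    [BorelSpace X] [SecondCountableTopology X] {A : Set X} {μ : Measure X} [SFinite μ]
    (hμ : μ ≠ 0) (hA : μ Aᶜ = 0) {t : ℝ≥0} (h : rieszEnergy t μ < ∞) : t ≤ dimH A := by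
  have hpot : Measurable fun x => ∫⁻ y, edist x y ^ (-t : ℝ) ∂μ :=
    Measurable.lintegral_prod_right' (f := fun p : X × X => edist p.1 p.2 ^ (-t : ℝ)) (by fun_prop)
  rw [rieszEnergy, lintegral_prod _ (by fun_prop)] at h
  obtain ⟨N, hN⟩ := exists_measure_le_natCast_ne_zero hμ (ae_lt_top hpot h.ne)
  set G := {x | ∫⁻ y, edist x y ^ (-t : ℝ) ∂μ ≤ N}
  have hG : MeasurableSet G := measurableSet_le hpot measurable_const
  have hN' : (N + 1 : ℝ≥0∞) ≠ ∞ := by finiteness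
  have hfrostman (U : Set X) (hU : ediam U ≤ 1) :
      ((N + 1 : ℝ≥0∞)⁻¹ • μ.restrict G) U ≤ ediam U ^ (t : ℝ) := by
    rw [Measure.smul_apply, Measure.restrict_apply' hG, smul_eq_mul,
      ENNReal.inv_mul_le_iff (by simp) hN']
    rcases (U ∩ G).eq_empty_or_nonempty with hempty | ⟨x, hxUG⟩
    · simp [hempty]
    have hdiam : ediam (U ∩ G) ≤ ediam U := ediam_mono inter_subset_left
    calc μ (U ∩ G) ≤ (N + 1) * ediam (U ∩ G) ^ (t : ℝ) :=
          measure_le_mul_ediam_rpow t.2 hxUG (ne_top_of_le_ne_top ENNReal.one_ne_top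
            (hdiam.trans hU)) hN' (le_trans hxUG.2 le_self_add)
      _ ≤ (N + 1) * ediam U ^ (t : ℝ) := by gcongr
  refine le_dimH_of_hausdorffMeasure_ne_zero fun hzero => hN ?_
  have hGA : (N + 1 : ℝ≥0∞)⁻¹ * μ (A ∩ G) = 0 := by
    have := (Measure.le_hausdorffMeasure (t : ℝ) _ 1 one_pos hfrostman A).trans_eq hzero
    rwa [Measure.smul_apply, Measure.restrict_apply' hG, smul_eq_mul, nonpos_iff_eq_zero] at this
  refine measure_mono_null (fun x hx => ?_)
    (measure_union_null ((mul_eq_zero.1 hGA).resolve_left (ENNReal.inv_ne_zero.2 hN')) hA)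
  by_cases hxA : x ∈ A
  · exact Or.inl ⟨hxA, hx⟩
  · exact Or.inr hxA

theorem sq_lintegral_le_measure_mul_lintegral_sq {Ω : Type*} [MeasurableSpace Ω] {μ : Measure Ω}
    {f : Ω → ℝ≥0∞} (hf : AEMeasurable f μ) {S : Set Ω} (hS : MeasurableSet S)
    (hfS : ∀ x ∉ S, f x = 0) : (∫⁻ x, f x ∂μ) ^ 2 ≤ μ S * ∫⁻ x, f x ^ 2 ∂μ := by
  have hsqrt (a : ℝ≥0∞) : (a ^ (1 / 2 : ℝ)) ^ 2 = a := by
    rw [← ENNReal.rpow_mul_natCast]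
    norm_num
  have hrestrict : ∫⁻ x in S, f x ∂μ = ∫⁻ x, f x ∂μ := by
    rw [← lintegral_indicator hS, indicator_eq_self.2 fun x hx => not_imp_comm.1 (hfS x) hx]
  have hholder : ∫⁻ x in S, f x ∂μ ≤ μ S ^ (1 / 2 : ℝ) * (∫⁻ x in S, f x ^ 2 ∂μ) ^ (1 / 2 : ℝ) := by
    simpa using ENNReal.lintegral_mul_le_Lp_mul_Lq (μ.restrict S) Real.HolderConjugate.two_two
      (f := 1) aemeasurable_one hf.restrict
  calc (∫⁻ x, f x ∂μ) ^ 2 ≤ (μ S ^ (1 / 2 : ℝ) * (∫⁻ x in S, f x ^ 2 ∂μ) ^ (1 / 2 : ℝ)) ^ 2 := by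
        rw [← hrestrict]
        gcongr
    _ = μ S * ∫⁻ x in S, f x ^ 2 ∂μ := by rw [mul_pow, hsqrt, hsqrt]
    _ ≤ μ S * ∫⁻ x, f x ^ 2 ∂μ := by
        gcongr
        exact Measure.restrict_le_self

section ClosedBall

variable {E : Type*} [NormedAddCommGroup E] [MeasurableSpace E] [BorelSpace E]
  [SecondCountableTopology E] (μ : Measure E) [μ.IsAddHaarMeasure] [SFinite μ]
  (σ : Measure E) [SFinite σ]

theorem measurable_measure_closedBall (r : ℝ) : Measurable fun x => σ (closedBall x r) := by
  convert! measurable_measure_prodMk_left (ν := σ) (measurableSet_dist_le (X := E) r) using 3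
  ext y
  simp [dist_comm]

theorem lintegral_measure_closedBall (r : ℝ) :
    ∫⁻ x, σ (closedBall x r) ∂μ = σ univ * μ (closedBall 0 r) := by
  have hball (x : E) : closedBall x r = Prod.mk x ⁻¹' {p | dist p.1 p.2 ≤ r} := by
    ext y
    simp [dist_comm]
  have hball' (y : E) : (fun x => (x, y)) ⁻¹' {p : E × E | dist p.1 p.2 ≤ r} = closedBall y r := rfl
  simp only [hball]
  rw [← Measure.prod_apply (measurableSet_dist_le r),
    Measure.prod_apply_symm (measurableSet_dist_le r)]
  simp only [hball', Measure.addHaar_closedBall_center, lintegral_const]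
  rw [mul_comm, ← hball]

theorem lintegral_sq_measure_closedBall_le (r : ℝ) :
    ∫⁻ x, σ (closedBall x r) ^ 2 ∂μ ≤ μ (closedBall 0 r) * correlationIntegral σ (2 * r) := by
  let S : Set (E × E × E) := {q | dist q.1 q.2.1 ≤ r ∧ dist q.1 q.2.2 ≤ r}
  have hS₁ : MeasurableSet {q : E × E × E | dist q.1 q.2.1 ≤ r} :=
    measurableSet_le (by fun_prop) measurable_const
  have hS₂ : MeasurableSet {q : E × E × E | dist q.1 q.2.2 ≤ r} :=
    measurableSet_le (by fun_prop) measurable_const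
  have hS : MeasurableSet S := hS₁.inter hS₂
  have hsq (x : E) : σ (closedBall x r) ^ 2 = (σ.prod σ) (Prod.mk x ⁻¹' S) := by
    rw [sq, ← Measure.prod_prod]
    congr 1
    ext p
    simp [S, dist_comm]
  have hsection (p : E × E) : μ ((fun x => (x, p)) ⁻¹' S) ≤
      {p : E × E | dist p.1 p.2 ≤ 2 * r}.indicator (fun _ => μ (closedBall 0 r)) p := by
    by_cases hp : dist p.1 p.2 ≤ 2 * r
    · rw [indicator_of_mem (show p ∈ {p : E × E | dist p.1 p.2 ≤ 2 * r} from hp),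
        ← Measure.addHaar_closedBall_center μ p.1]
      exact measure_mono fun x hx => hx.1
    · have hempty : (fun x => (x, p)) ⁻¹' S = ∅ := by
        refine eq_empty_of_forall_notMem fun x hx => hp ?_
        linarith [dist_triangle_left p.1 p.2 x, hx.1, hx.2]
      simp [hempty]
  calc ∫⁻ x, σ (closedBall x r) ^ 2 ∂μ = ∫⁻ p, μ ((fun x => (x, p)) ⁻¹' S) ∂σ.prod σ := by
        simp only [hsq]
        rw [← Measure.prod_apply hS, Measure.prod_apply_symm hS]
    _ ≤ ∫⁻ p, {p : E × E | dist p.1 p.2 ≤ 2 * r}.indicator (fun _ => μ (closedBall 0 r)) p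
          ∂σ.prod σ := lintegral_mono hsection
    _ = μ (closedBall 0 r) * correlationIntegral σ (2 * r) :=
        lintegral_indicator_const (measurableSet_dist_le _) _

variable {σ}

theorem sq_measure_univ_mul_le {K : Set E} (hσ : σ Kᶜ = 0) {r : ℝ} (hr0 : μ (closedBall 0 r) ≠ 0)
    (hr : μ (closedBall 0 r) ≠ ∞) :
    σ univ ^ 2 * μ (closedBall 0 r) ≤ μ (cthickening r K) * correlationIntegral σ (2 * r) := by
  have hsupp (x : E) (hx : x ∉ cthickening r K) : σ (closedBall x r) = 0 := by
    refine measure_mono_null (t := Kᶜ) (fun y hy hyK => hx ?_) hσ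
    exact mem_cthickening_of_dist_le x y r K hyK (mem_closedBall'.1 hy)
  refine (ENNReal.mul_le_mul_iff_left hr0 hr).1 ?_
  calc σ univ ^ 2 * μ (closedBall 0 r) * μ (closedBall 0 r)
      = (∫⁻ x, σ (closedBall x r) ∂μ) ^ 2 := by rw [lintegral_measure_closedBall]; ring
    _ ≤ μ (cthickening r K) * ∫⁻ x, σ (closedBall x r) ^ 2 ∂μ :=
        sq_lintegral_le_measure_mul_lintegral_sq (measurable_measure_closedBall σ r).aemeasurable
          isClosed_cthickening.measurableSet hsupp
    _ ≤ μ (cthickening r K) * (μ (closedBall 0 r) * correlationIntegral σ (2 * r)) := by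
        gcongr
        exact lintegral_sq_measure_closedBall_le μ σ r
    _ = μ (cthickening r K) * correlationIntegral σ (2 * r) * μ (closedBall 0 r) := by ring

end ClosedBall

theorem measure_pos_of_frequently_correlationIntegral_le {E : Type*} [NormedAddCommGroup E]
    [NormedSpace ℝ E] [FiniteDimensional ℝ E] [MeasurableSpace E] [BorelSpace E] {μ : Measure E}
    [μ.IsAddHaarMeasure] {σ : Measure E} [SFinite σ] (hσ0 : σ ≠ 0) {K : Set E} (hK : IsCompact K)
    (hσ : σ Kᶜ = 0) {C : ℝ≥0∞} (hC : C ≠ ∞) {r : ℕ → ℝ} (hr : ∀ n, 0 < r n)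
    (hr0 : Tendsto r atTop (𝓝 0))
    (h : ∃ᶠ n in atTop, correlationIntegral σ (r n) ≤ C * μ (closedBall 0 (r n))) : 0 < μ K := by
  set D := C * ENNReal.ofReal (2 ^ Module.finrank ℝ E)
  have hhalf : Tendsto (fun n => r n / 2) atTop (𝓝 0) := by simpa using hr0.div_const 2
  have hlim : Tendsto (fun n => μ (cthickening (r n / 2) K) * D) atTop (𝓝 (μ K * D)) :=
    ENNReal.Tendsto.mul_const ((tendsto_measure_cthickening_of_isCompact hK).comp hhalf)
      (Or.inr (by finiteness))
  have hle : σ univ ^ 2 ≤ μ K * D := by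
    refine ge_of_tendsto_of_frequently hlim (h.mono fun n hn => ?_)
    have hpos : μ (closedBall 0 (r n / 2)) ≠ 0 := (measure_closedBall_pos μ 0 (half_pos (hr n))).ne'
    have hfin : μ (closedBall 0 (r n / 2)) ≠ ∞ := measure_closedBall_lt_top.ne
    refine (ENNReal.mul_le_mul_iff_left hpos hfin).1 ?_
    calc σ univ ^ 2 * μ (closedBall 0 (r n / 2))
        ≤ μ (cthickening (r n / 2) K) * correlationIntegral σ (2 * (r n / 2)) :=
          sq_measure_univ_mul_le μ hσ hpos hfin
      _ ≤ μ (cthickening (r n / 2) K) * (C * μ (closedBall 0 (2 * (r n / 2)))) := by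
          rw [mul_div_cancel₀ _ two_ne_zero]
          gcongr
      _ = μ (cthickening (r n / 2) K) * D * μ (closedBall 0 (r n / 2)) := by
          rw [Measure.addHaar_closedBall_mul_of_pos μ _ two_pos]
          ring
  refine pos_iff_ne_zero.2 fun hzero => hσ0 ?_
  simpa [hzero] using hle

theorem ae_frequently_correlationIntegral_map_le {Θ Ω E : Type*} [MeasurableSpace Θ]
    [MeasurableSpace Ω] [PseudoMetricSpace E] [MeasurableSpace E] [OpensMeasurableSpace E]
    [SecondCountableTopology E] {Q : Measure Θ} [SFinite Q] {P : Measure Ω} [SFinite P]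
    {T : Θ → Ω → E} (hT : Measurable (Function.uncurry T)) {k : Ω × Ω → ℝ≥0∞}
    (hk : ∫⁻ q, k q ∂P.prod P ≠ ∞) {r : ℕ → ℝ} {v : ℕ → ℝ≥0∞} (hv0 : ∀ n, v n ≠ 0)
    (hv : ∀ n, v n ≠ ∞)
    (h : ∀ n, ∀ᵐ q ∂P.prod P, Q {θ | dist (T θ q.1) (T θ q.2) ≤ r n} ≤ v n * k q) :
    ∀ᵐ θ ∂Q, ∃ C ≠ ∞, ∃ᶠ n in atTop, correlationIntegral (P.map (T θ)) (r n) ≤ C * v n := by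
  let S (n : ℕ) : Set (Θ × Ω × Ω) := {q | dist (T q.1 q.2.1) (T q.1 q.2.2) ≤ r n}
  have hS (n : ℕ) : MeasurableSet (S n) :=
    measurableSet_le ((hT.comp (f := fun q : Θ × Ω × Ω => (q.1, q.2.1)) (by fun_prop)).dist
      (hT.comp (f := fun q : Θ × Ω × Ω => (q.1, q.2.2)) (by fun_prop))) measurable_const
  let Φ (n : ℕ) (θ : Θ) : ℝ≥0∞ := (v n)⁻¹ * (P.prod P) (Prod.mk θ ⁻¹' S n)
  have hΦ (n : ℕ) : Measurable (Φ n) := (measurable_measure_prodMk_left (hS n)).const_mul _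
  have hmean (n : ℕ) : ∫⁻ θ, Φ n θ ∂Q ≤ ∫⁻ q, k q ∂P.prod P := by
    rw [lintegral_const_mul' _ _ (ENNReal.inv_ne_top.2 (hv0 n)), ← Measure.prod_apply (hS n),
      Measure.prod_apply_symm (hS n), ENNReal.inv_mul_le_iff (hv0 n) (hv n),
      ← lintegral_const_mul' _ _ (hv n)]
    exact lintegral_mono_ae (h n)
  have hfatou : ∫⁻ θ, liminf (fun n => Φ n θ) atTop ∂Q ≤ ∫⁻ q, k q ∂P.prod P :=
    (lintegral_liminf_le hΦ).trans (liminf_le_of_frequently_le' (Frequently.of_forall hmean))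
  filter_upwards [ae_lt_top (Measurable.liminf hΦ) (ne_top_of_le_ne_top hk hfatou)] with θ hθ
  obtain ⟨C, hliminf, hC⟩ := exists_between hθ
  refine ⟨C, hC.ne, (frequently_lt_of_liminf_lt (h := hliminf)).mono fun n hn => ?_⟩
  have hTθ : Measurable (T θ) := hT.comp measurable_prodMk_left
  rw [correlationIntegral_map hTθ, mul_comm,
    ← ENNReal.inv_mul_le_iff (hv0 n) (hv n)]
  exact hn.le

section Strip

theorem volume_abs_mul_add_le_mul_enorm_le (u κ r : ℝ) :
    volume {a : ℝ | |a * u + κ| ≤ r} * ‖u‖ₑ ≤ ENNReal.ofReal (2 * r) := by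
  rcases eq_or_ne u 0 with rfl | hu
  · simp
  have hball : {a : ℝ | |a * u + κ| ≤ r} = (· * u) ⁻¹' closedBall (-κ) r := by
    ext a
    simp [Real.dist_eq]
  rw [hball, Real.volume_preimage_mul_right hu, Real.volume_closedBall, mul_right_comm, abs_inv,
    ← Real.norm_eq_abs, ← ofReal_norm, ← ENNReal.ofReal_mul (by positivity),
    inv_mul_cancel₀ (norm_ne_zero_iff.2 hu), ENNReal.ofReal_one, one_mul]

theorem measurableSet_strip (u v w r : ℝ) :
    MeasurableSet {θ : ℝ × ℝ | |θ.1 * u + θ.2 * v + w| ≤ r} :=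
  measurableSet_le (by fun_prop) measurable_const

theorem prod_strip_mul_enorm_fst_le {μ ν : Measure ℝ} [SFinite μ] [IsProbabilityMeasure ν]
    (hμ : μ ≤ volume) (u v w r : ℝ) :
    (μ.prod ν) {θ | |θ.1 * u + θ.2 * v + w| ≤ r} * ‖u‖ₑ ≤ ENNReal.ofReal (2 * r) := by
  rw [Measure.prod_apply_symm (measurableSet_strip u v w r),
    ← lintegral_mul_const' _ _ enorm_ne_top]
  calc _ ≤ ∫⁻ _, ENNReal.ofReal (2 * r) ∂ν := lintegral_mono fun b => by
        refine le_trans ?_ (volume_abs_mul_add_le_mul_enorm_le u (b * v + w) r)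
        refine mul_le_mul' ((hμ _).trans_eq ?_) le_rfl
        simp only [preimage_ofPred_eq, add_assoc]
    _ = ENNReal.ofReal (2 * r) := by simp

theorem prod_strip_mul_enorm_snd_le {μ ν : Measure ℝ} [IsProbabilityMeasure μ] [SFinite ν]
    (hν : ν ≤ volume) (u v w r : ℝ) :
    (μ.prod ν) {θ | |θ.1 * u + θ.2 * v + w| ≤ r} * ‖v‖ₑ ≤ ENNReal.ofReal (2 * r) := by
  rw [← Measure.prod_swap, Measure.map_apply measurable_swap (measurableSet_strip u v w r)]
  simpa [add_comm] using prod_strip_mul_enorm_fst_le (μ := ν) (ν := μ) hν v u w r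

/-- Lebesgue measure on the square `[1, 2]²`, from which the coefficients of an affine map
`c ↦ a + b * c` are drawn. -/
noncomputable def parameterMeasure : Measure (ℝ × ℝ) :=
  (volume.restrict (Icc 1 2)).prod (volume.restrict (Icc 1 2))

instance isProbabilityMeasure_parameterMeasure : IsProbabilityMeasure parameterMeasure := by
  have hI : IsProbabilityMeasure (volume.restrict (Icc (1 : ℝ) 2)) := ⟨by norm_num⟩
  unfold parameterMeasure
  infer_instance

theorem ae_parameterMeasure_mem :
    ∀ᵐ θ ∂parameterMeasure, θ.1 ∈ Icc (1 : ℝ) 2 ∧ θ.2 ∈ Icc (1 : ℝ) 2 := by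
  rw [parameterMeasure, Measure.prod_restrict]
  exact ae_restrict_mem (measurableSet_Icc.prod measurableSet_Icc)

theorem abs_le_two_mul_abs_mul_add_mul_add {a b u v w : ℝ} (ha : a ∈ Icc (1 : ℝ) 2)
    (hb : b ∈ Icc (1 : ℝ) 2) (hu : 8 * |u| ≤ |w|) (hv : 8 * |v| ≤ |w|) :
    |w| ≤ 2 * |a * u + b * v + w| := by
  have hau : |a * u| ≤ 2 * |u| := by
    rw [abs_mul, abs_of_nonneg (zero_le_one.trans ha.1)]
    gcongr
    exact ha.2
  have hbv : |b * v| ≤ 2 * |v| := by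
    rw [abs_mul, abs_of_nonneg (zero_le_one.trans hb.1)]
    gcongr
    exact hb.2
  have hw : |w| ≤ |a * u + b * v + w| + |a * u| + |b * v| :=
    calc |w| = |a * u + b * v + w - a * u - b * v| := by ring_nf
      _ ≤ |a * u + b * v + w - a * u| + |b * v| := abs_sub _ _
      _ ≤ |a * u + b * v + w| + |a * u| + |b * v| := by gcongr; exact abs_sub _ _
  linarith

-- Either `x.1` or `x.2.1` is comparable to `‖x‖` and one averages over its coefficient, or `x.2.2`
-- dominates and the strip is empty for small `r`.
theorem parameterMeasure_strip_mul_enorm_le (x : ℝ × ℝ × ℝ) (r : ℝ) :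
    parameterMeasure {θ | |θ.1 * x.1 + θ.2 * x.2.1 + x.2.2| ≤ r} * ‖x‖ₑ ≤
      8 * ENNReal.ofReal (2 * r) := by
  obtain ⟨u, v, w⟩ := x
  have hI : IsProbabilityMeasure (volume.restrict (Icc (1 : ℝ) 2)) := ⟨by norm_num⟩
  set p := parameterMeasure {θ | |θ.1 * u + θ.2 * v + w| ≤ r}
  have hu : p * ‖u‖ₑ ≤ ENNReal.ofReal (2 * r) :=
    prod_strip_mul_enorm_fst_le Measure.restrict_le_self u v w r
  have hv : p * ‖v‖ₑ ≤ ENNReal.ofReal (2 * r) :=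
    prod_strip_mul_enorm_snd_le Measure.restrict_le_self u v w r
  have hmono {t : ℝ} (ht : p * ‖t‖ₑ ≤ ENNReal.ofReal (2 * r)) (htw : ‖(u, v, w)‖ ≤ 8 * |t|) :
      p * ‖(u, v, w)‖ₑ ≤ 8 * ENNReal.ofReal (2 * r) := by
    have h : ‖(u, v, w)‖ₑ ≤ 8 * ‖t‖ₑ := by
      rw [← ofReal_norm, ← ofReal_norm, Real.norm_eq_abs t, ← ENNReal.ofReal_ofNat 8,
        ← ENNReal.ofReal_mul (by norm_num)]
      exact ENNReal.ofReal_le_ofReal htw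
    calc p * ‖(u, v, w)‖ₑ ≤ p * (8 * ‖t‖ₑ) := by gcongr
      _ = 8 * (p * ‖t‖ₑ) := by ring
      _ ≤ 8 * ENNReal.ofReal (2 * r) := by gcongr
  rcases le_or_gt ‖(u, v, w)‖ (8 * |u|) with hu8 | hu8
  · exact hmono hu hu8
  rcases le_or_gt ‖(u, v, w)‖ (8 * |v|) with hv8 | hv8
  · exact hmono hv hv8
  have hnorm : ‖(u, v, w)‖ = |w| := by
    have : ‖(u, v, w)‖ = max |u| (max |v| |w|) := rfl
    grind
  rw [hnorm] at hu8 hv8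
  rw [← ofReal_norm, hnorm]
  rcases le_or_gt |w| (2 * r) with hwr | hwr
  · calc p * ENNReal.ofReal |w| ≤ 1 * ENNReal.ofReal (2 * r) := by gcongr; exact prob_le_one
      _ ≤ 8 * ENNReal.ofReal (2 * r) := by gcongr; norm_num
  · have hp : p = 0 := measure_eq_zero_iff_ae_notMem.2 <| by
      filter_upwards [ae_parameterMeasure_mem] with θ hθ hθr
      have := abs_le_two_mul_abs_mul_add_mul_add hθ.1 hθ.2 hu8.le hv8.le
      exact absurd hθr (not_le.2 (by linarith))
    simp [hp]

end Strip

section Transversality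

theorem dist_le_mul_dist_mul_coordinate {L m : ℝ} (hm : 0 < m) {p q : ℝ × ℝ × ℝ} (hp : |p.1| ≤ L)
    (hq : m ≤ |q.2.1|) :
    dist p q ≤ (1 + (1 + L) / m) *
      ‖(p.2.1 - q.2.1, p.1 * p.2.1 - q.1 * q.2.1, p.2.2 - q.2.2)‖ := by
  have hL : 0 ≤ L := (abs_nonneg _).trans hp
  set M := ‖(p.2.1 - q.2.1, p.1 * p.2.1 - q.1 * q.2.1, p.2.2 - q.2.2)‖
  have hu : |p.2.1 - q.2.1| ≤ M := norm_fst_le (p.2.1 - q.2.1, _)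
  have hv : |p.1 * p.2.1 - q.1 * q.2.1| ≤ M :=
    (norm_fst_le (p.1 * p.2.1 - q.1 * q.2.1, _)).trans (norm_snd_le (p.2.1 - q.2.1, _))
  have hw : |p.2.2 - q.2.2| ≤ M :=
    (norm_snd_le (p.1 * p.2.1 - q.1 * q.2.1, p.2.2 - q.2.2)).trans (norm_snd_le (p.2.1 - q.2.1, _))
  have hM : 0 ≤ M := norm_nonneg _
  have hfst : |p.1 - q.1| * m ≤ (1 + L) * M :=
    calc |p.1 - q.1| * m ≤ |p.1 - q.1| * |q.2.1| := by gcongr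
      _ = |(p.1 * p.2.1 - q.1 * q.2.1) - p.1 * (p.2.1 - q.2.1)| := by rw [← abs_mul]; ring_nf
      _ ≤ |p.1 * p.2.1 - q.1 * q.2.1| + |p.1| * |p.2.1 - q.2.1| := by
        rw [← abs_mul]; exact abs_sub _ _
      _ ≤ M + L * M := by gcongr
      _ = (1 + L) * M := by ring
  rw [← le_div_iff₀ hm, mul_div_right_comm] at hfst
  have hκ : 0 ≤ (1 + L) / m * M := by positivity
  rw [add_mul, one_mul, Prod.dist_eq, Prod.dist_eq, Real.dist_eq, Real.dist_eq, Real.dist_eq]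
  exact max_le (by linarith) (max_le (by linarith) (by linarith))

/-- The point `(a + b * c) * y + z` of `(a + b C) Y + Z`, for `θ = (a, b)` and `p = (c, y, z)`. -/
def affineSum (θ : ℝ × ℝ) (p : ℝ × ℝ × ℝ) : ℝ :=
  (θ.1 + θ.2 * p.1) * p.2.1 + p.2.2

theorem measurable_uncurry_affineSum : Measurable (Function.uncurry affineSum) := by
  unfold affineSum
  simp only [Function.uncurry_def]
  fun_prop

theorem parameterMeasure_dist_affineSum_le {L m : ℝ} (hm : 0 < m) {p q : ℝ × ℝ × ℝ}
    (hp : |p.1| ≤ L) (hq : m ≤ |q.2.1|) {r : ℝ} (hr : 0 < r) :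
    parameterMeasure {θ | dist (affineSum θ p) (affineSum θ q) ≤ r} ≤
      volume (closedBall (0 : ℝ) r) *
        (8 * ENNReal.ofReal (1 + (1 + L) / m) * edist p q ^ (-1 : ℝ)) := by
  set x : ℝ × ℝ × ℝ := (p.2.1 - q.2.1, p.1 * p.2.1 - q.1 * q.2.1, p.2.2 - q.2.2) with hx
  set κ := 1 + (1 + L) / m
  have hL : 0 ≤ L := (abs_nonneg _).trans hp
  have hκ : 0 < κ := by positivity
  have hset : {θ : ℝ × ℝ | dist (affineSum θ p) (affineSum θ q) ≤ r} =
      {θ | |θ.1 * x.1 + θ.2 * x.2.1 + x.2.2| ≤ r} := by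
    ext θ
    simp only [affineSum, Real.dist_eq, mem_ofPred_eq, hx]
    ring_nf
  have hdist : edist p q ≤ ENNReal.ofReal κ * ‖x‖ₑ := by
    rw [edist_dist, ← ofReal_norm, ← ENNReal.ofReal_mul hκ.le]
    exact ENNReal.ofReal_le_ofReal (dist_le_mul_dist_mul_coordinate hm hp hq)
  rw [hset, ENNReal.rpow_neg_one, ← mul_assoc, ← div_eq_mul_inv]
  have hc : volume (closedBall (0 : ℝ) r) * (8 * ENNReal.ofReal κ) ≠ 0 := by
    simp [hr, hκ]
  refine (ENNReal.le_div_iff_mul_le (Or.inr hc) (Or.inl (edist_ne_top _ _))).2 ?_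
  calc _ ≤ parameterMeasure _ * (ENNReal.ofReal κ * ‖x‖ₑ) := by gcongr
    _ = ENNReal.ofReal κ * (parameterMeasure _ * ‖x‖ₑ) := by ring
    _ ≤ ENNReal.ofReal κ * (8 * ENNReal.ofReal (2 * r)) := by
      exact mul_le_mul_right (parameterMeasure_strip_mul_enorm_le x r) _
    _ = _ := by rw [Real.volume_closedBall]; ring

theorem ae_mem_prod_prod {A B Z : Set ℝ} {ρ μ ν : Measure ℝ} (hρ : ρ Aᶜ = 0) (hμ : μ Bᶜ = 0)
    (hν : ν Zᶜ = 0) :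
    ∀ᵐ p ∂ρ.prod (μ.prod ν), p.1 ∈ A ∧ p.2.1 ∈ B ∧ p.2.2 ∈ Z := by
  have hA : ∀ᵐ x ∂ρ, x ∈ A := hρ
  have hB : ∀ᵐ x ∂μ, x ∈ B := hμ
  have hZ : ∀ᵐ x ∂ν, x ∈ Z := hν
  exact (Measure.quasiMeasurePreserving_fst.ae hA).and <| Measure.quasiMeasurePreserving_snd.ae <|
    (Measure.quasiMeasurePreserving_fst.ae hB).and (Measure.quasiMeasurePreserving_snd.ae hZ)

theorem ae_frequently_correlationIntegral_map_affineSum_le {A B Z : Set ℝ} {ρ μ ν : Measure ℝ}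
    [IsFiniteMeasure ρ] [IsFiniteMeasure μ] [IsFiniteMeasure ν] (hA : Bornology.IsBounded A)
    {m : ℝ} (hm : 0 < m) (hBm : ∀ y ∈ B, m ≤ |y|) (hρ : ρ Aᶜ = 0) (hμ : μ Bᶜ = 0) (hν : ν Zᶜ = 0)
    (h : rieszEnergy 1 (ρ.prod (μ.prod ν)) < ∞) {r : ℕ → ℝ} (hr : ∀ n, 0 < r n) :
    ∀ᵐ θ ∂parameterMeasure, ∃ C ≠ ∞, ∃ᶠ n in atTop,
      correlationIntegral ((ρ.prod (μ.prod ν)).map (affineSum θ)) (r n) ≤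
        C * volume (closedBall (0 : ℝ) (r n)) := by
  set P := ρ.prod (μ.prod ν)
  obtain ⟨L, hL⟩ := hA.exists_norm_le
  set c := 8 * ENNReal.ofReal (1 + (1 + L) / m)
  have hmem : ∀ᵐ p ∂P, p.1 ∈ A ∧ p.2.1 ∈ B ∧ p.2.2 ∈ Z := ae_mem_prod_prod hρ hμ hν
  refine ae_frequently_correlationIntegral_map_le measurable_uncurry_affineSum
    (k := fun q => c * edist q.1 q.2 ^ (-1 : ℝ)) ?_ (fun n => by simp [hr n])
    (fun n => measure_closedBall_lt_top.ne) fun n => ?_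
  · rw [lintegral_const_mul' _ _ (by finiteness)]
    exact ENNReal.mul_ne_top (by finiteness) h.ne
  · filter_upwards [Measure.quasiMeasurePreserving_fst.ae hmem,
      Measure.quasiMeasurePreserving_snd.ae hmem] with q hp hq
    exact parameterMeasure_dist_affineSum_le hm (hL _ hp.1) (hBm _ hq.2.1) (hr n)

theorem ae_volume_image_affine_mul_add_pos {A B Z : Set ℝ} {ρ μ ν : Measure ℝ}
    [IsFiniteMeasure ρ] [IsFiniteMeasure μ] [IsFiniteMeasure ν] (hA : IsCompact A)
    (hB : IsCompact B) (hZ : IsCompact Z) (hB0 : 0 ∉ B) (hρ0 : ρ ≠ 0) (hμ0 : μ ≠ 0) (hν0 : ν ≠ 0)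
    (hρ : ρ Aᶜ = 0) (hμ : μ Bᶜ = 0) (hν : ν Zᶜ = 0)
    (h : rieszEnergy 1 (ρ.prod (μ.prod ν)) < ∞) :
    ∀ᵐ θ ∂parameterMeasure, 0 < volume ((fun c => θ.1 + θ.2 * c) '' A * B + Z) := by
  obtain ⟨m, hm, hBm⟩ : ∃ m > 0, ∀ y ∈ B, m ≤ |y| := by
    obtain ⟨m, hm, hmB⟩ := Metric.isOpen_iff.1 hB.isClosed.isOpen_compl 0 hB0
    refine ⟨m, hm, fun y hy => not_lt.1 fun hlt => hmB (by simpa using hlt) hy⟩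
  have hP0 : ρ.prod (μ.prod ν) ≠ 0 := by
    simp [← Measure.measure_univ_ne_zero, ← univ_prod_univ, hρ0, hμ0, hν0]
  filter_upwards [ae_frequently_correlationIntegral_map_affineSum_le hA.isBounded hm hBm hρ hμ hν h
    (r := fun n => (1 / 2) ^ n) (fun n => by positivity)] with θ ⟨C, hC, hθ⟩
  have hT : Measurable (affineSum θ) :=
    measurable_uncurry_affineSum.comp (measurable_const.prodMk measurable_id)
  have hK : IsCompact ((fun c => θ.1 + θ.2 * c) '' A * B + Z) :=
    ((hA.image (by fun_prop)).mul hB).add hZ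
  refine measure_pos_of_frequently_correlationIntegral_le
    (by rwa [Ne, Measure.map_eq_zero_iff hT.aemeasurable]) hK ?_ hC (fun n => by positivity)
    (tendsto_pow_atTop_nhds_zero_of_lt_one (by norm_num) (by norm_num)) hθ
  rw [Measure.map_apply hT hK.measurableSet.compl, measure_eq_zero_iff_ae_notMem]
  filter_upwards [ae_mem_prod_prod hρ hμ hν] with p hp hmem
  exact hmem (add_mem_add (mul_mem_mul (mem_image_of_mem _ hp.1) hp.2.1) hp.2.2)

end Transversality

section CorrelationCarrier

/-- `A` carries a non-zero, compactly supported finite measure with correlation exponent `s`. -/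
def SupportsCorrelationDecay (A : Set ℝ) (s : ℝ) : Prop :=
  ∃ μ ∈ compactlySupportedMeasures A, HasCorrelationDecay μ s

theorem mem_compactlySupportedMeasures {A : Set ℝ} (hA : IsCompact A) {μ : Measure ℝ}
    [IsFiniteMeasure μ] (h0 : μ ≠ 0) (h : μ Aᶜ = 0) : μ ∈ compactlySupportedMeasures A := by
  have hsub : μ.support ⊆ A := Measure.support_subset_of_isClosed hA.isClosed h
  exact ⟨inferInstance, h0, hA.of_isClosed_subset Measure.isClosed_support hsub, hsub⟩

theorem compactlySupportedMeasures_mono {A B : Set ℝ} (h : A ⊆ B) :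
    compactlySupportedMeasures A ⊆ compactlySupportedMeasures B :=
  fun _ hμ => ⟨hμ.1, hμ.2.1, hμ.2.2.1, hμ.2.2.2.trans h⟩

theorem SupportsCorrelationDecay.mono {A B : Set ℝ} {s : ℝ} (hA : SupportsCorrelationDecay A s)
    (h : A ⊆ B) : SupportsCorrelationDecay B s :=
  hA.imp fun _ hμ => ⟨compactlySupportedMeasures_mono h hμ.1, hμ.2⟩

theorem exists_affine_volume_pos {A B Z : Set ℝ} (hB0 : 0 ∉ B) {s₁ s₂ s₃ : ℝ}
    (hA : SupportsCorrelationDecay A s₁) (hB : SupportsCorrelationDecay B s₂)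
    (hZ : SupportsCorrelationDecay Z s₃) (hs : 1 < s₁ + s₂ + s₃) :
    ∃ a ∈ Icc (1 : ℝ) 2, ∃ b ∈ Icc (1 : ℝ) 2, 0 < volume ((fun c => a + b * c) '' A * B + Z) := by
  obtain ⟨ρ, ⟨hρf, hρ0, hρK, hρA⟩, hρ⟩ := hA
  obtain ⟨μ, ⟨hμf, hμ0, hμK, hμB⟩, hμ⟩ := hB
  obtain ⟨ν, ⟨hνf, hν0, hνK, hνZ⟩, hν⟩ := hZ
  have henergy : rieszEnergy 1 (ρ.prod (μ.prod ν)) < ∞ :=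
    (hρ.prod (hμ.prod hν)).rieszEnergy_lt_top one_pos (by linarith)
  obtain ⟨θ, hpos, ha, hb⟩ := ((ae_volume_image_affine_mul_add_pos hρK hμK hνK
    (fun h => hB0 (hμB h)) hρ0 hμ0 hν0 Measure.measure_compl_support Measure.measure_compl_support
    Measure.measure_compl_support henergy).and ae_parameterMeasure_mem).exists
  exact ⟨θ.1, ha, θ.2, hb, hpos.trans_le (measure_mono
    (add_subset_add (mul_subset_mul (image_mono hρA) hμB) hνZ))⟩

end CorrelationCarrier

section FourierDecay

theorem measureFourier_eq_charFun (μ : Measure ℝ) (ξ : ℝ) :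
    measureFourier μ ξ = charFun μ (-2 * Real.pi * ξ) := by
  rw [measureFourier, charFun_apply_real]
  congr with x
  push_cast
  ring_nf

theorem norm_measureFourier_le (μ : Measure ℝ) (ξ : ℝ) : ‖measureFourier μ ξ‖ ≤ μ.real univ := by
  rw [measureFourier_eq_charFun]
  exact norm_charFun_le _

theorem integral_charFun_comm {E : Type*} [NormedAddCommGroup E] [InnerProductSpace ℝ E]
    [MeasurableSpace E] [BorelSpace E] [SecondCountableTopology E] (μ ν : Measure E)
    [IsFiniteMeasure μ] [IsFiniteMeasure ν] : ∫ t, charFun μ t ∂ν = ∫ x, charFun ν x ∂μ := by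
  simp only [charFun_apply]
  rw [integral_integral_swap]
  · simp only [real_inner_comm]
  · refine (integrable_const (1 : ℝ)).mono' (by fun_prop) (ae_of_all _ fun p => ?_)
    exact (Complex.norm_exp_ofReal_mul_I _).le

theorem charFun_map_sub {E : Type*} [NormedAddCommGroup E] [InnerProductSpace ℝ E]
    [MeasurableSpace E] [BorelSpace E] [SecondCountableTopology E] (μ : Measure E)
    [IsFiniteMeasure μ] (t : E) :
    charFun ((μ.prod μ).map fun p => p.1 - p.2) t = ((‖charFun μ t‖ ^ 2 : ℝ) : ℂ) := by
  rw [charFun_apply, integral_map (by fun_prop) (by fun_prop), Complex.ofReal_pow,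
    ← Complex.mul_conj', ← charFun_neg, charFun_apply, charFun_apply, ← integral_prod_mul]
  congr with p
  rw [← Complex.exp_add, inner_sub_left, inner_neg_right]
  push_cast
  ring_nf

theorem integral_sq_norm_charFun {E : Type*} [NormedAddCommGroup E] [InnerProductSpace ℝ E]
    [MeasurableSpace E] [BorelSpace E] [SecondCountableTopology E] (μ ν : Measure E)
    [IsFiniteMeasure μ] [IsFiniteMeasure ν] :
    ((∫ t, ‖charFun μ t‖ ^ 2 ∂ν : ℝ) : ℂ) = ∫ p, charFun ν (p.1 - p.2) ∂μ.prod μ := by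
  rw [← integral_complex_ofReal]
  simp only [← charFun_map_sub]
  rw [integral_charFun_comm, integral_map (by fun_prop) (by fun_prop)]

theorem integral_sq_norm_charFun_gaussianReal (μ : Measure ℝ) [IsFiniteMeasure μ] :
    ∫ t, ‖charFun μ t‖ ^ 2 ∂ProbabilityTheory.gaussianReal 0 1 =
      ∫ p, Real.exp (-(p.1 - p.2) ^ 2 / 2) ∂μ.prod μ := by
  rw [← Complex.ofReal_inj, integral_sq_norm_charFun, ← integral_complex_ofReal]
  congr with p
  rw [ProbabilityTheory.charFun_gaussianReal]
  push_cast
  ring_nf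

theorem correlationIntegral_one_le_lintegral_charFun (μ : Measure ℝ) [IsFiniteMeasure μ] :
    correlationIntegral μ 1 ≤ ENNReal.ofReal (Real.exp 2⁻¹) *
      ∫⁻ t, ‖charFun μ t‖ₑ ^ 2 ∂ProbabilityTheory.gaussianReal 0 1 := by
  have hlint : ∫⁻ t, ‖charFun μ t‖ₑ ^ 2 ∂ProbabilityTheory.gaussianReal 0 1 =
      ∫⁻ p, ENNReal.ofReal (Real.exp (-(p.1 - p.2) ^ 2 / 2)) ∂μ.prod μ := by
    simp_rw [← ofReal_norm, ← ENNReal.ofReal_pow (norm_nonneg _)]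
    rw [← ofReal_integral_eq_lintegral_ofReal, ← ofReal_integral_eq_lintegral_ofReal,
      integral_sq_norm_charFun_gaussianReal]
    · refine (integrable_const (1 : ℝ)).mono' (by fun_prop) (ae_of_all _ fun p => ?_)
      rw [Real.norm_of_nonneg (Real.exp_nonneg _), Real.exp_le_one_iff]
      nlinarith [sq_nonneg (p.1 - p.2)]
    · exact ae_of_all _ fun p => Real.exp_nonneg _
    · refine (integrable_const (μ.real univ ^ 2)).mono' (by fun_prop) (ae_of_all _ fun t => ?_)
      rw [norm_pow, norm_norm]
      gcongr
      exact norm_charFun_le t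
    · exact ae_of_all _ fun t => by positivity
  rw [hlint, ← lintegral_const_mul _ (by fun_prop), correlationIntegral,
    ← lintegral_indicator_one (measurableSet_dist_le 1)]
  refine lintegral_mono (indicator_le' (fun p hp => ?_) fun _ _ => zero_le)
  rw [Pi.one_apply, ← ENNReal.ofReal_mul (Real.exp_nonneg _), ENNReal.one_le_ofReal,
    ← Real.exp_add, Real.one_le_exp_iff]
  have hp' : (p.1 - p.2) ^ 2 ≤ 1 := (sq_le_one_iff_abs_le_one _).2 hp
  linarith

theorem lintegral_enorm_rpow_neg_gaussianReal_lt_top {s : ℝ} (hs : s < 1) :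
    ∫⁻ t, ‖t‖ₑ ^ (-s) ∂ProbabilityTheory.gaussianReal 0 1 < ∞ := by
  have hint : Integrable fun t : ℝ => |t| ^ (-s) * Real.exp (-2⁻¹ * |t| ^ (2 : ℝ)) := by
    refine .of_integral_ne_zero ?_
    rw [integral_comp_abs (f := fun t : ℝ => t ^ (-s) * Real.exp (-2⁻¹ * t ^ (2 : ℝ))),
      integral_rpow_mul_exp_neg_mul_rpow two_pos (by linarith) (by norm_num)]
    have : 0 < Real.Gamma ((-s + 1) / 2) := Real.Gamma_pos_of_pos (by linarith)
    positivity
  rw [ProbabilityTheory.gaussianReal_of_var_ne_zero _ one_ne_zero,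
    lintegral_withDensity_eq_lintegral_mul _ (ProbabilityTheory.measurable_gaussianPDF _ _)
      (by fun_prop)]
  refine lt_of_le_of_lt ?_ (hint.const_mul (√(2 * Real.pi))⁻¹).hasFiniteIntegral
  refine lintegral_mono_ae ((Measure.ae_ne volume 0).mono fun t ht => le_of_eq ?_)
  have hpdf : ProbabilityTheory.gaussianPDFReal 0 1 t * |t| ^ (-s) =
      (√(2 * Real.pi))⁻¹ * (|t| ^ (-s) * Real.exp (-2⁻¹ * |t| ^ (2 : ℝ))) := by
    rw [ProbabilityTheory.gaussianPDFReal, Real.rpow_two, sq_abs]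
    simp only [NNReal.coe_one, mul_one, sub_zero]
    ring_nf
  dsimp only
  rw [← hpdf, Pi.mul_apply, ProbabilityTheory.gaussianPDF, ← ofReal_norm t,
    ENNReal.ofReal_rpow_of_pos (norm_pos_iff.2 ht),
    ← ENNReal.ofReal_mul (ProbabilityTheory.gaussianPDFReal_nonneg _ _ _), Real.norm_eq_abs,
    Real.enorm_of_nonneg (mul_nonneg (ProbabilityTheory.gaussianPDFReal_nonneg _ _ _)
      (Real.rpow_nonneg (abs_nonneg _) _))]

theorem HasFourierDecay.enorm_charFun_le {μ : Measure ℝ} {s : ℝ} (h : HasFourierDecay μ s) :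
    ∃ C : ℝ≥0, ∀ t ≠ 0, ‖charFun μ t‖ₑ ^ 2 ≤ C * ‖t‖ₑ ^ (-s) := by
  obtain ⟨C, hC⟩ := h
  refine ⟨(C * (2 * Real.pi) ^ s).toNNReal, fun t ht => ?_⟩
  have hξ : -2 * Real.pi * (-t / (2 * Real.pi)) = t := by field_simp
  have hdecay : ‖charFun μ t‖ ^ 2 * (|t| / (2 * Real.pi)) ^ s ≤ C := by
    have := hC ⟨-t / (2 * Real.pi), rfl⟩
    dsimp only at this
    rwa [measureFourier_eq_charFun, hξ, abs_div, abs_neg,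
      abs_of_pos Real.two_pi_pos] at this
  have ht' : 0 < |t| := abs_pos.2 ht
  rw [← ofReal_norm, ← ofReal_norm, ENNReal.ofReal_rpow_of_pos (norm_pos_iff.2 ht),
    ← ENNReal.ofReal_pow (norm_nonneg _), ← ENNReal.ofReal_coe_nnreal,
    ← ENNReal.ofReal_mul NNReal.zero_le_coe]
  refine ENNReal.ofReal_le_ofReal (le_trans ?_
    (mul_le_mul_of_nonneg_right (Real.le_coe_toNNReal _) (by positivity)))
  rw [Real.div_rpow ht'.le Real.two_pi_pos.le, ← mul_div_assoc,
    div_le_iff₀ (by positivity)] at hdecay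
  rwa [Real.norm_eq_abs t, Real.rpow_neg ht'.le, ← div_eq_mul_inv, le_div_iff₀ (by positivity)]

theorem correlationIntegral_map_mul (μ : Measure ℝ) [SFinite μ] {c : ℝ} (hc : 0 < c) (r : ℝ) :
    correlationIntegral (μ.map (c * ·)) r = correlationIntegral μ (r / c) := by
  rw [correlationIntegral_map (by fun_prop), correlationIntegral]
  congr with p
  rw [le_div_iff₀' hc, Real.dist_eq, Real.dist_eq, ← mul_sub,
    abs_mul, abs_of_pos hc]

theorem HasFourierDecay.hasCorrelationDecay {μ : Measure ℝ} [IsFiniteMeasure μ] {s : ℝ}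
    (hs : s < 1) (h : HasFourierDecay μ s) : HasCorrelationDecay μ s := by
  obtain ⟨C, hC⟩ := h.enorm_charFun_le
  set D := ENNReal.ofReal (Real.exp 2⁻¹) *
    (C * ∫⁻ t, ‖t‖ₑ ^ (-s) ∂ProbabilityTheory.gaussianReal 0 1)
  have hD : D ≠ ∞ := ENNReal.mul_ne_top (by finiteness)
    (ENNReal.mul_ne_top (by finiteness) (lintegral_enorm_rpow_neg_gaussianReal_lt_top hs).ne)
  refine ⟨D.toNNReal, fun r hr => ?_⟩
  have hr' : 0 < r⁻¹ := inv_pos.2 hr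
  have hscale : ‖r⁻¹‖ₑ ^ (-s) = ENNReal.ofReal (r ^ s) := by
    rw [← ofReal_norm, Real.norm_of_nonneg hr'.le, ENNReal.ofReal_rpow_of_pos hr',
      Real.inv_rpow hr.le, Real.rpow_neg hr.le, inv_inv]
  have hmap : correlationIntegral (μ.map (r⁻¹ * ·)) 1 = correlationIntegral μ r := by
    rw [correlationIntegral_map_mul μ hr', one_div, inv_inv]
  rw [← hmap, ENNReal.coe_toNNReal hD, mul_assoc, ← lintegral_const_mul' _ _ ENNReal.coe_ne_top,
    ← lintegral_mul_const' _ _ ENNReal.ofReal_ne_top]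
  refine (correlationIntegral_one_le_lintegral_charFun _).trans ?_
  gcongr ENNReal.ofReal (Real.exp 2⁻¹) * ?_
  have := ProbabilityTheory.nullSingletonClass_gaussianReal (μ := 0) one_ne_zero
  refine lintegral_mono_ae ((Measure.ae_ne _ 0).mono fun t ht => ?_)
  rw [charFun_map_mul, ← hscale, mul_assoc, ← ENNReal.mul_rpow_of_ne_top enorm_ne_top enorm_ne_top,
    ← enorm_mul, mul_comm t]
  exact hC _ (mul_ne_zero hr'.ne' ht)

theorem HasFourierDecay.mono {μ : Measure ℝ} {s t : ℝ} (ht : 0 ≤ t) (hts : t ≤ s)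
    (h : HasFourierDecay μ s) : HasFourierDecay μ t := by
  obtain ⟨C, hC⟩ := h
  refine ⟨max C (μ.real univ ^ 2), ?_⟩
  rintro _ ⟨ξ, rfl⟩
  dsimp only
  rcases le_total 1 |ξ| with hξ | hξ
  · calc ‖measureFourier μ ξ‖ ^ 2 * |ξ| ^ t ≤ ‖measureFourier μ ξ‖ ^ 2 * |ξ| ^ s := by gcongr
      _ ≤ max C (μ.real univ ^ 2) := (hC ⟨ξ, rfl⟩).trans (le_max_left _ _)
  · calc ‖measureFourier μ ξ‖ ^ 2 * |ξ| ^ t ≤ μ.real univ ^ 2 * 1 := by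
          gcongr
          · exact norm_measureFourier_le μ ξ
          · exact Real.rpow_le_one (abs_nonneg _) hξ ht
      _ ≤ max C (μ.real univ ^ 2) := by simp

end FourierDecay

section Dimensions

theorem supportsCorrelationDecay_zero {A : Set ℝ} (hA : A.Nonempty) :
    SupportsCorrelationDecay A 0 := by
  obtain ⟨x, hx⟩ := hA
  refine ⟨.dirac x, ?_, 1, fun r _ => by simpa using! prob_le_one⟩
  have hmem : Measure.dirac x ∈ compactlySupportedMeasures {x} :=
    mem_compactlySupportedMeasures isCompact_singleton Measure.dirac_ne_zero (by simp)
  exact compactlySupportedMeasures_mono (singleton_subset_iff.2 hx) hmem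

theorem SupportsCorrelationDecay.ofReal_le_dimH {A : Set ℝ} {s : ℝ}
    (h : SupportsCorrelationDecay A s) : ENNReal.ofReal s ≤ dimH A := by
  obtain ⟨μ, ⟨hμf, hμ0, -, hμA⟩, hμ⟩ := h
  refine ENNReal.le_of_forall_nnreal_lt fun t hts => ?_
  rcases eq_or_ne t 0 with rfl | ht
  · simp
  have hts' : (t : ℝ) < s := by
    simpa using (ENNReal.lt_ofReal_iff_toReal_lt ENNReal.coe_ne_top).1 hts
  exact le_dimH_of_rieszEnergy_lt_top hμ0
    (measure_mono_null (compl_subset_compl.2 hμA) Measure.measure_compl_support)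
    (hμ.rieszEnergy_lt_top (NNReal.coe_pos.2 (pos_iff_ne_zero.2 ht)) hts')

theorem supportsCorrelationDecay_of_lt_fourierDim {A : Set ℝ} {t : ℝ≥0}
    (h : (t : ℝ≥0∞) < fourierDim A) : SupportsCorrelationDecay A t := by
  obtain ⟨s, hs⟩ := lt_iSup_iff.1 h
  obtain ⟨⟨hs1, μ, hμ, hdecay⟩, hts⟩ := lt_iSup_iff.1 hs
  have hts : t < s := ENNReal.coe_lt_coe.1 hts
  have : IsFiniteMeasure μ := hμ.1
  exact ⟨μ, hμ, (hdecay.mono t.2 hts.le).hasCorrelationDecay (hts.trans_le hs1)⟩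

theorem fourierDim_le_dimH (A : Set ℝ) : fourierDim A ≤ dimH A :=
  ENNReal.le_of_forall_nnreal_lt fun t ht => by
    simpa using (supportsCorrelationDecay_of_lt_fourierDim ht).ofReal_le_dimH

theorem HasCorrelationDecay.measure_singleton {X : Type*} [PseudoMetricSpace X]
    [MeasurableSpace X] {μ : Measure X} [SFinite μ] {s : ℝ} (hs : 0 < s)
    (h : HasCorrelationDecay μ s) (x : X) : μ {x} = 0 := by
  obtain ⟨C, hC⟩ := h
  have hlim : Tendsto (fun r : ℝ => C * ENNReal.ofReal (r ^ s)) (𝓝[>] 0) (𝓝 0) := by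
    have h0 : Tendsto (fun r : ℝ => r ^ s) (𝓝 0) (𝓝 0) := by
      simpa [Real.zero_rpow hs.ne'] using (Real.continuousAt_rpow_const 0 s (Or.inr hs.le)).tendsto
    simpa using ENNReal.Tendsto.const_mul (a := (C : ℝ≥0∞)) (ENNReal.tendsto_ofReal
      (h0.mono_left nhdsWithin_le_nhds)) (Or.inr ENNReal.coe_ne_top)
  have hle : μ {x} * μ {x} ≤ 0 := by
    rw [← Measure.prod_prod]
    refine ge_of_tendsto hlim (eventually_mem_nhdsWithin.mono fun r hr => ?_)
    refine (measure_mono ?_).trans (hC r hr)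
    rintro ⟨y, z⟩ ⟨hy, hz⟩
    obtain rfl : y = x := hy
    obtain rfl : z = y := hz
    simpa using! (mem_Ioi.1 hr).le
  simpa using hle

theorem HasCorrelationDecay.restrict {X : Type*} [PseudoMetricSpace X]
    [MeasurableSpace X] {μ : Measure X} [SFinite μ] {s : ℝ}
    (h : HasCorrelationDecay μ s) (A : Set X) : HasCorrelationDecay (μ.restrict A) s := by
  obtain ⟨C, hC⟩ := h
  refine ⟨C, fun r hr => le_trans ?_ (hC r hr)⟩
  rw [correlationIntegral, Measure.prod_restrict]
  exact Measure.restrict_apply_le _ _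

theorem SupportsCorrelationDecay.diff_singleton {A : Set ℝ} {s : ℝ} (hs : 0 < s)
    (h : SupportsCorrelationDecay A s) (x : ℝ) : SupportsCorrelationDecay (A \ {x}) s := by
  obtain ⟨μ, ⟨hμf, hμ0, hμK, hμA⟩, hμ⟩ := h
  have hpos : 0 < μ (μ.support \ {x}) := by
    rw [measure_sdiff_null (hμ.measure_singleton hs x),
      measure_of_measure_compl_eq_zero Measure.measure_compl_support]
    exact Measure.measure_univ_pos.2 hμ0
  obtain ⟨K, hKsub, hK, hμKpos⟩ :=
    (hμK.measurableSet.diff (measurableSet_singleton x)).exists_lt_isCompact hpos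
  refine ⟨μ.restrict K, compactlySupportedMeasures_mono (hKsub.trans (sdiff_subset_sdiff_left hμA))
    (mem_compactlySupportedMeasures hK (by simpa using hμKpos.ne') ?_), hμ.restrict K⟩
  rw [Measure.restrict_apply hK.measurableSet.compl, compl_inter_self, measure_empty]

end Dimensions

section Frostman

/-- The `t`-dimensional Hausdorff content: the infimum of `∑ ediam (U n) ^ t` over all countable
covers, with no restriction on the size of the covering sets. -/
noncomputable def hausdorffContent {X : Type*} [EMetricSpace X] (t : ℝ) : OuterMeasure X :=
  .boundedBy fun U => ediam U ^ t

theorem hausdorffContent_le_ediam_rpow {X : Type*} [EMetricSpace X] (t : ℝ) (U : Set X) :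
    hausdorffContent t U ≤ ediam U ^ t :=
  OuterMeasure.boundedBy_le U

theorem hausdorffMeasure_eq_zero_of_hausdorffContent_eq_zero {X : Type*} [EMetricSpace X]
    [MeasurableSpace X] [BorelSpace X] {t : ℝ} (ht : 0 < t) {A : Set X}
    (h : hausdorffContent t A = 0) : μH[t] A = 0 := by
  rw [Measure.hausdorffMeasure_apply, ← nonpos_iff_eq_zero]
  refine iSup₂_le fun r hr => ENNReal.le_of_forall_pos_le_add fun ε hε _ => ?_
  have hpos : hausdorffContent t A < min (ε : ℝ≥0∞) (r ^ t) := by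
    rw [h]
    exact lt_min (ENNReal.coe_pos.2 hε) (ENNReal.rpow_pos_of_nonneg hr ht.le)
  rw [hausdorffContent, OuterMeasure.boundedBy_apply] at hpos
  obtain ⟨U, hU⟩ := iInf_lt_iff.1 hpos
  obtain ⟨hAU, hU⟩ := iInf_lt_iff.1 hU
  rw [lt_min_iff] at hU
  have hsmall (n : ℕ) : ediam (U n) ≤ r := by
    rcases (U n).eq_empty_or_nonempty with hn | hn
    · simp [hn]
    · refine ((ENNReal.rpow_lt_rpow_iff ht).1 (lt_of_le_of_lt ?_ hU.2)).le
      exact (le_iSup (fun _ : (U n).Nonempty => ediam (U n) ^ t) hn).trans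
        (ENNReal.le_tsum (f := fun n => ⨆ _ : (U n).Nonempty, ediam (U n) ^ t) n)
  rw [zero_add]
  exact (iInf₂_le U hAU).trans ((iInf_le _ hsmall).trans hU.1.le)

theorem exists_measure_Ioc_eq_sub {m : OuterMeasure ℝ} (hm : m univ ≠ ∞) {t : ℝ} (ht : 0 < t)
    (hIoc : ∀ x y, m (Ioc x y) ≤ ENNReal.ofReal (y - x) ^ t) :
    ∃ μ : Measure ℝ, IsFiniteMeasure μ ∧ ∀ x y, μ (Ioc x y) = m (Iic y) - m (Iic x) := by
  have hfin (x : ℝ) : m (Iic x) ≠ ∞ := ne_top_of_le_ne_top hm (measure_mono (subset_univ _))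
  have hmono : Monotone fun x => m (Iic x) := fun x y h => measure_mono (Iic_subset_Iic.2 h)
  have hcont (x : ℝ) : ContinuousWithinAt (fun y => m (Iic y)) (Ici x) x := by
    have hlim : Tendsto (fun y => m (Iic x) + ENNReal.ofReal (y - x) ^ t) (𝓝[≥] x)
        (𝓝 (m (Iic x))) := by
      have : Continuous fun y => m (Iic x) + ENNReal.ofReal (y - x) ^ t :=
        continuous_const.add (ENNReal.continuous_rpow_const.comp
          (ENNReal.continuous_ofReal.comp (continuous_sub_right x)))
      simpa [ENNReal.zero_rpow_of_pos ht] using (this.tendsto x).mono_left nhdsWithin_le_nhds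
    refine tendsto_of_tendsto_of_tendsto_of_le_of_le' tendsto_const_nhds hlim
      (eventually_mem_nhdsWithin.mono fun y hy => hmono hy)
      (eventually_mem_nhdsWithin.mono fun y hy => ?_)
    rw [← Iic_union_Ioc_eq_Iic (mem_Ici.1 hy)]
    exact (measure_union_le _ _).trans (add_le_add_right (hIoc x y) _)
  let F : StieltjesFunction ℝ :=
    { toFun := fun x => (m (Iic x)).toReal
      mono' := fun x y h => ENNReal.toReal_mono (hfin y) (hmono h)
      right_continuous' := fun x => (ENNReal.tendsto_toReal (hfin x)).comp (hcont x) }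
  refine ⟨F.measure, F.isFiniteMeasure_of_forall_abs_le (C := (m univ).toReal) fun x => ?_,
    fun x y => ?_⟩
  · exact (abs_of_nonneg ENNReal.toReal_nonneg).trans_le
      (ENNReal.toReal_mono hm (measure_mono (subset_univ _)))
  · rw [F.measure_Ioc, ENNReal.ofReal_sub _ ENNReal.toReal_nonneg, ENNReal.ofReal_toReal (hfin y),
      ENNReal.ofReal_toReal (hfin x)]

theorem hasCorrelationDecay_of_measure_closedBall_le {X : Type*} [PseudoMetricSpace X]
    [MeasurableSpace X] [OpensMeasurableSpace X] [SecondCountableTopology X] {μ : Measure X}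
    [IsFiniteMeasure μ] {s : ℝ} {C : ℝ≥0}
    (h : ∀ x, ∀ r > 0, μ (closedBall x r) ≤ C * ENNReal.ofReal (r ^ s)) :
    HasCorrelationDecay μ s := by
  refine ⟨C * (μ univ).toNNReal, fun r hr => ?_⟩
  rw [correlationIntegral, Measure.prod_apply (measurableSet_dist_le r), ENNReal.coe_mul,
    ENNReal.coe_toNNReal (measure_ne_top μ _), mul_right_comm, ← lintegral_const]
  refine lintegral_mono fun x => (measure_mono fun y hy => ?_).trans (h x r hr)
  exact mem_closedBall'.2 hy

theorem measure_compl_eq_zero_of_disjoint_Ioc {A : Set ℝ} (hA : IsClosed A) {μ : Measure ℝ}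
    (h : ∀ x y, Disjoint (Ioc x y) A → μ (Ioc x y) = 0) : μ Aᶜ = 0 := by
  refine measure_null_of_locally_null _ fun x hx => ?_
  obtain ⟨ε, hε, hball⟩ := Metric.isOpen_iff.1 hA.isOpen_compl x hx
  refine ⟨Ioc (x - ε) (x + ε / 2), mem_nhdsWithin_of_mem_nhds
    (Ioc_mem_nhds (by linarith) (by linarith)), h _ _ ?_⟩
  refine subset_compl_iff_disjoint_right.1 (subset_trans ?_ hball)
  exact Real.ball_eq_Ioo x ε ▸ Ioc_subset_Ioo_right (by linarith)

theorem exists_measure_closedBall_le {A : Set ℝ} (hA : IsCompact A) {t : ℝ} (ht : 0 < t)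
    (h : hausdorffContent t A ≠ 0) : ∃ μ ∈ compactlySupportedMeasures A,
      ∀ x, ∀ r > 0, μ (closedBall x r) ≤ ENNReal.ofReal (3 * r) ^ t := by
  set m := OuterMeasure.restrict A (hausdorffContent t) with hm
  have hmIoc (x y : ℝ) : m (Ioc x y) ≤ ENNReal.ofReal (y - x) ^ t :=
    (OuterMeasure.restrict_le_self _ _ _).trans
      ((hausdorffContent_le_ediam_rpow t _).trans_eq (by rw [Real.ediam_Ioc]))
  have hm0 {U : Set ℝ} (hU : U ∩ A = ∅) : m U = 0 := by
    rw [hm, OuterMeasure.restrict_apply, hU, measure_empty]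
  have hmA {U : Set ℝ} (hU : A ⊆ U) : m U = hausdorffContent t A := by
    rw [hm, OuterMeasure.restrict_apply, inter_eq_right.2 hU]
  have hfin : m univ ≠ ∞ := by
    rw [hmA (subset_univ A)]
    exact ne_top_of_le_ne_top (ENNReal.rpow_ne_top_of_nonneg ht.le hA.isBounded.ediam_ne_top)
      (hausdorffContent_le_ediam_rpow t A)
  obtain ⟨μ, hμ, hμm⟩ := exists_measure_Ioc_eq_sub hfin ht hmIoc
  have hμ_le (x y : ℝ) : μ (Ioc x y) ≤ m (Ioc x y) := by
    rw [hμm, tsub_le_iff_left]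
    exact (measure_mono fun z hz => (le_or_gt z x).imp id fun hx => ⟨hx, hz⟩).trans
      (measure_union_le _ _)
  have hμ0 : μ ≠ 0 := by
    obtain ⟨a, ha⟩ := hA.bddBelow
    obtain ⟨b, hb⟩ := hA.bddAbove
    have hab := hμm (a - 1) b
    have hempty : Iic (a - 1) ∩ A = ∅ :=
      eq_empty_of_forall_notMem fun x hx => by linarith [mem_Iic.1 hx.1, ha hx.2]
    rw [hmA (U := Iic b) fun x hx => hb hx, hm0 hempty, tsub_zero] at hab
    exact fun h0 => h (by rw [← hab, h0, Measure.coe_zero, Pi.zero_apply])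
  have hμA : μ Aᶜ = 0 := measure_compl_eq_zero_of_disjoint_Ioc hA.isClosed fun x y hxy =>
    le_zero_iff.1 ((hμ_le x y).trans_eq (hm0 hxy.inter_eq))
  refine ⟨μ, mem_compactlySupportedMeasures hA hμ0 hμA, fun x r hr => ?_⟩
  calc μ (closedBall x r) ≤ μ (Ioc (x - 2 * r) (x + r)) := by
        rw [Real.closedBall_eq_Icc]
        exact measure_mono (Icc_subset_Ioc (by linarith) le_rfl)
    _ ≤ ENNReal.ofReal (x + r - (x - 2 * r)) ^ t := (hμ_le _ _).trans (hmIoc _ _)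
    _ = ENNReal.ofReal (3 * r) ^ t := by ring_nf

theorem supportsCorrelationDecay_of_hausdorffContent_ne_zero {A : Set ℝ} (hA : IsCompact A) {t : ℝ}
    (ht : 0 < t) (h : hausdorffContent t A ≠ 0) : SupportsCorrelationDecay A t := by
  obtain ⟨μ, hμ, hball⟩ := exists_measure_closedBall_le hA ht h
  have := hμ.1
  refine ⟨μ, hμ, hasCorrelationDecay_of_measure_closedBall_le (C := 3 ^ t) fun x r hr =>
    (hball x r hr).trans_eq ?_⟩
  rw [ENNReal.ofReal_mul zero_le_three, ENNReal.mul_rpow_of_nonneg _ _ ht.le,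
    ENNReal.ofReal_rpow_of_pos hr, ENNReal.ofReal_ofNat, ENNReal.coe_rpow_of_nonneg _ ht.le,
    ENNReal.coe_ofNat]

theorem supportsCorrelationDecay_of_lt_dimH {Z : Set ℝ} (hZ : IsClosed Z) {t : ℝ≥0} (ht0 : 0 < t)
    (ht : t < dimH Z) : SupportsCorrelationDecay Z t := by
  have hcover : Z = ⋃ k : ℕ, Z ∩ closedBall 0 k := by
    rw [← inter_iUnion, iUnion_closedBall_nat, inter_univ]
  rw [hcover, dimH_iUnion, lt_iSup_iff] at ht
  obtain ⟨k, hk⟩ := ht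
  have hcontent : hausdorffContent t (Z ∩ closedBall 0 k) ≠ 0 := fun h0 => by
    have hzero := hausdorffMeasure_eq_zero_of_hausdorffContent_eq_zero (NNReal.coe_pos.2 ht0) h0
    exact ENNReal.zero_ne_top (hzero.symm.trans (hausdorffMeasure_of_lt_dimH hk))
  exact (supportsCorrelationDecay_of_hausdorffContent_ne_zero
    ((isCompact_closedBall 0 k).inter_left hZ) ht0 hcontent).mono inter_subset_left

end Frostman

section LatticeFourierNorm

theorem one_add_enorm_add_rpow_le {E : Type*} [TopologicalSpace E] [ESeminormedAddMonoid E]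
    {γ : ℝ} (hγ : 0 ≤ γ) (x y : E) : (1 + ‖x + y‖ₑ) ^ γ ≤ (1 + ‖x‖ₑ) ^ γ * (1 + ‖y‖ₑ) ^ γ := by
  rw [← ENNReal.mul_rpow_of_nonneg _ _ hγ]
  refine ENNReal.rpow_le_rpow ?_ hγ
  calc 1 + ‖x + y‖ₑ ≤ 1 + (‖x‖ₑ + ‖y‖ₑ) := by gcongr; exact enorm_add_le x y
    _ ≤ 1 + (‖x‖ₑ + ‖y‖ₑ) + ‖x‖ₑ * ‖y‖ₑ := le_self_add
    _ = (1 + ‖x‖ₑ) * (1 + ‖y‖ₑ) := by ring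

/-- The amalgam norm `sup_ξ ∑_k (1 + |ξ - k|) ^ γ * |ρ̂(ξ - k)|` over translates of the lattice `ℤ`.
It controls the weighted Fourier transform of `ρ` and, unlike a supremum norm, is stable under
multiplication of `ρ` by a Fourier series with summable weighted coefficients. -/
noncomputable def latticeFourierNorm (γ : ℝ) (ρ : Measure ℝ) : ℝ≥0∞ :=
  ⨆ ξ : ℝ, ∑' k : ℤ, (1 + ‖ξ - k‖ₑ) ^ γ * ‖measureFourier ρ (ξ - k)‖ₑ

theorem tsum_le_latticeFourierNorm (γ : ℝ) (ρ : Measure ℝ) (ξ : ℝ) :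
    ∑' k : ℤ, (1 + ‖ξ - k‖ₑ) ^ γ * ‖measureFourier ρ (ξ - k)‖ₑ ≤ latticeFourierNorm γ ρ :=
  le_iSup (fun ξ : ℝ => ∑' k : ℤ, (1 + ‖ξ - k‖ₑ) ^ γ * ‖measureFourier ρ (ξ - k)‖ₑ) ξ

theorem rpow_mul_enorm_measureFourier_le (γ : ℝ) (ρ : Measure ℝ) (ξ : ℝ) :
    (1 + ‖ξ‖ₑ) ^ γ * ‖measureFourier ρ ξ‖ₑ ≤ latticeFourierNorm γ ρ := by
  refine le_trans ?_ ((ENNReal.le_tsum 0).trans (tsum_le_latticeFourierNorm γ ρ ξ))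
  rw [Int.cast_zero, sub_zero]

theorem latticeFourierNorm_mono {γ γ' : ℝ} (h : γ ≤ γ') (ρ : Measure ℝ) :
    latticeFourierNorm γ ρ ≤ latticeFourierNorm γ' ρ :=
  iSup_mono fun _ => ENNReal.tsum_le_tsum fun _ =>
    mul_le_mul_left (ENNReal.rpow_le_rpow_of_exponent_le le_self_add h) _

theorem rpow_mul_enorm_le_tsum {γ : ℝ} (hγ : 0 ≤ γ) {ρ : Measure ℝ} {a : ℤ → ℂ} {ξ : ℝ} {z : ℂ}
    (h : HasSum (fun k : ℤ => a k * measureFourier ρ (ξ - k)) z) :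
    (1 + ‖ξ‖ₑ) ^ γ * ‖z‖ₑ ≤ ∑' k : ℤ, (1 + ‖(k : ℝ)‖ₑ) ^ γ * ‖a k‖ₑ *
      ((1 + ‖ξ - k‖ₑ) ^ γ * ‖measureFourier ρ (ξ - k)‖ₑ) := by
  rw [← h.tsum_eq]
  calc _ ≤ (1 + ‖ξ‖ₑ) ^ γ * ∑' k : ℤ, ‖a k‖ₑ * ‖measureFourier ρ (ξ - k)‖ₑ := by
        simp_rw [← enorm_mul]
        exact mul_le_mul_right (enorm_tsum_le_tsum_enorm) _
    _ ≤ _ := by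
        rw [← ENNReal.tsum_mul_left]
        refine ENNReal.tsum_le_tsum fun k => ?_
        rw [mul_mul_mul_comm]
        refine mul_le_mul_left ?_ _
        simpa using one_add_enorm_add_rpow_le hγ (k : ℝ) (ξ - k)

variable {ρ : Measure ℝ} [IsFiniteMeasure ρ] {F : ℝ → ℝ} {a : ℤ → ℂ}

theorem isFiniteMeasure_withDensity_of_hasSum (hFm : Measurable F) (ha : Summable a)
    (hF : ∀ x, HasSum (fun k : ℤ => a k * 𝐞 (k * x)) (F x)) :
    IsFiniteMeasure (ρ.withDensity fun x => ENNReal.ofReal (F x)) := by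
  have hbound (x : ℝ) : ‖F x‖ ≤ ∑' k, ‖a k‖ := by
    rw [← Complex.norm_real, ← (hF x).tsum_eq]
    exact tsum_of_norm_bounded ha.norm.hasSum fun k => by rw [norm_mul, Circle.norm_coe, mul_one]
  exact isFiniteMeasure_withDensity_ofReal
    ((integrable_const (∑' k, ‖a k‖)).mono' hFm.aestronglyMeasurable (ae_of_all _ hbound)).2

theorem hasSum_measureFourier_withDensity (hFm : Measurable F) (hF0 : 0 ≤ F) (ha : Summable a)
    (hF : ∀ x, HasSum (fun k : ℤ => a k * 𝐞 (k * x)) (F x)) (ξ : ℝ) :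
    HasSum (fun k : ℤ => a k * measureFourier ρ (ξ - k))
      (measureFourier (ρ.withDensity fun x => ENNReal.ofReal (F x)) ξ) := by
  have hker (x ξ : ℝ) : Complex.exp (-2 * Real.pi * Complex.I * x * ξ) = 𝐞 (-(x * ξ)) := by
    rw [Real.fourierChar_apply]
    push_cast
    ring_nf
  simp only [measureFourier, hker]
  have hint : ∫ x, (𝐞 (-(x * ξ)) : ℂ) ∂ρ.withDensity (fun x => ENNReal.ofReal (F x)) =
      ∫ x, ∑' k : ℤ, a k * 𝐞 (-(x * (ξ - k))) ∂ρ := by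
    rw [integral_withDensity_eq_integral_toReal_smul (by fun_prop)
      (ae_of_all _ fun x => ENNReal.ofReal_lt_top)]
    congr with x
    rw [ENNReal.toReal_ofReal (hF0 x), Complex.real_smul, ← (hF x).tsum_eq, ← tsum_mul_right]
    congr with k
    rw [mul_assoc, ← Circle.coe_mul, ← AddChar.map_add_eq_mul]
    ring_nf
  have hnorm (k : ℤ) (x : ℝ) : ‖a k * 𝐞 (-(x * (ξ - k)))‖ = ‖a k‖ := by
    rw [norm_mul, Circle.norm_coe, mul_one]
  rw [hint]
  simp only [← integral_const_mul]
  refine hasSum_integral_of_summable_integral_norm (fun k => ?_) ?_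
  · exact (integrable_const ‖a k‖).mono' (by fun_prop) (ae_of_all _ fun x => (hnorm k x).le)
  · simp only [hnorm, integral_const, smul_eq_mul]
    exact ha.norm.mul_left _

theorem latticeFourierNorm_withDensity_le {γ : ℝ} (hγ : 0 ≤ γ) (hFm : Measurable F) (hF0 : 0 ≤ F)
    (ha : Summable a) (hF : ∀ x, HasSum (fun k : ℤ => a k * 𝐞 (k * x)) (F x)) :
    latticeFourierNorm γ (ρ.withDensity fun x => ENNReal.ofReal (F x)) ≤
      (∑' k : ℤ, (1 + ‖(k : ℝ)‖ₑ) ^ γ * ‖a k‖ₑ) * latticeFourierNorm γ ρ := by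
  refine iSup_le fun ξ => ?_
  refine (ENNReal.tsum_le_tsum fun m : ℤ => rpow_mul_enorm_le_tsum hγ
    (hasSum_measureFourier_withDensity hFm hF0 ha hF (ξ - m))).trans ?_
  rw [ENNReal.tsum_comm, ← ENNReal.tsum_mul_right]
  refine ENNReal.tsum_le_tsum fun k => ?_
  rw [ENNReal.tsum_mul_left]
  simp_rw [sub_right_comm ξ _ (k : ℝ)]
  exact mul_le_mul_right (tsum_le_latticeFourierNorm γ ρ (ξ - k)) _

theorem rpow_mul_enorm_measureFourier_withDensity_sub_le {γ : ℝ} (hγ : 0 ≤ γ) (hFm : Measurable F)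
    (hF0 : 0 ≤ F) (ha : Summable a) (hF : ∀ x, HasSum (fun k : ℤ => a k * 𝐞 (k * x)) (F x))
    (ha0 : a 0 = 1) {ε : ℝ≥0∞} (hε : ∀ k : ℤ, k ≠ 0 → (1 + ‖(k : ℝ)‖ₑ) ^ γ * ‖a k‖ₑ ≤ ε) (ξ : ℝ) :
    (1 + ‖ξ‖ₑ) ^ γ * ‖measureFourier (ρ.withDensity fun x => ENNReal.ofReal (F x)) ξ -
      measureFourier ρ ξ‖ₑ ≤ ε * latticeFourierNorm γ ρ := by
  have hsum : HasSum (fun k : ℤ => Function.update a 0 0 k * measureFourier ρ (ξ - k))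
      (measureFourier (ρ.withDensity fun x => ENNReal.ofReal (F x)) ξ - measureFourier ρ ξ) := by
    have h := (hasSum_measureFourier_withDensity (ρ := ρ) hFm hF0 ha hF ξ).update 0 0
    rw [ha0, one_mul, Int.cast_zero, sub_zero, zero_sub, neg_add_eq_sub] at h
    refine h.congr_fun fun k => ?_
    rcases eq_or_ne k 0 with rfl | hk
    · rw [Function.update_self, Function.update_self, zero_mul]
    · rw [Function.update_of_ne hk, Function.update_of_ne hk]
  refine (rpow_mul_enorm_le_tsum hγ hsum).trans ?_
  refine (ENNReal.tsum_le_tsum fun k => mul_le_mul_left ?_ _).trans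
    (ENNReal.tsum_mul_left.trans_le (mul_le_mul_right (tsum_le_latticeFourierNorm γ ρ ξ) ε))
  rcases eq_or_ne k 0 with rfl | hk
  · simp
  · simpa [hk] using hε k hk

end LatticeFourierNorm

section SmoothMeasure

theorem tsum_one_add_enorm_rpow_neg_lt_top {β : ℝ} (hβ : 1 < β) :
    ∑' k : ℤ, (1 + ‖(k : ℝ)‖ₑ) ^ (-β) < ∞ := by
  have hnat : Summable fun n : ℕ => (1 + |(n : ℝ)|) ^ (-β) := by
    refine ((Real.summable_one_div_nat_add_rpow 1 β).2 hβ).congr fun n => ?_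
    rw [Real.rpow_neg (by positivity), one_div, abs_of_nonneg (by positivity), Nat.abs_cast,
      add_comm]
  have hint : Summable fun k : ℤ => (1 + |(k : ℝ)|) ^ (-β) :=
    .of_nat_of_neg (by simpa using hnat) (by simpa using hnat)
  convert hint.tsum_ofReal_lt_top with k
  rw [← ENNReal.ofReal_rpow_of_pos (by positivity), ENNReal.ofReal_add zero_le_one (abs_nonneg _),
    ENNReal.ofReal_one, Real.enorm_eq_ofReal_abs]

theorem tsum_one_add_enorm_sub_rpow_neg_le {β : ℝ} (hβ : 0 ≤ β) (ξ : ℝ) :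
    ∑' k : ℤ, (1 + ‖ξ - k‖ₑ) ^ (-β) ≤ 2 ^ β * ∑' k : ℤ, (1 + ‖(k : ℝ)‖ₑ) ^ (-β) := by
  rw [← (Equiv.addLeft ⌊ξ⌋).tsum_eq, ← ENNReal.tsum_mul_left]
  refine ENNReal.tsum_le_tsum fun k => ?_
  have hfract : ‖Int.fract ξ‖ₑ ≤ 1 := by
    rw [Real.enorm_eq_ofReal (Int.fract_nonneg ξ), ENNReal.ofReal_le_one]
    exact (Int.fract_lt_one ξ).le
  have hsplit : (k : ℝ) = -(ξ - (⌊ξ⌋ + k : ℤ)) + Int.fract ξ := by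
    rw [← Int.self_sub_floor]
    push_cast
    ring
  rw [Equiv.coe_addLeft, ENNReal.rpow_neg, ENNReal.rpow_neg, ← div_eq_mul_inv,
    ← ENNReal.inv_div (by simp) (by simp), ENNReal.inv_le_inv]
  refine ENNReal.div_le_of_le_mul' ?_
  calc (1 + ‖(k : ℝ)‖ₑ) ^ β
      ≤ (1 + ‖-(ξ - (⌊ξ⌋ + k : ℤ))‖ₑ) ^ β * (1 + ‖Int.fract ξ‖ₑ) ^ β := by
        rw [hsplit]
        exact one_add_enorm_add_rpow_le hβ _ _
    _ ≤ (1 + ‖ξ - (⌊ξ⌋ + k : ℤ)‖ₑ) ^ β * 2 ^ β := by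
        rw [enorm_neg, ← one_add_one_eq_two]
        gcongr
    _ = 2 ^ β * (1 + ‖ξ - (⌊ξ⌋ + k : ℤ)‖ₑ) ^ β := mul_comm _ _

theorem latticeFourierNorm_lt_top {γ : ℝ} (hγ : γ < 1) {ρ : Measure ℝ} {C : ℝ≥0}
    (h : ∀ ξ, ‖measureFourier ρ ξ‖ₑ ≤ C * (1 + ‖ξ‖ₑ) ^ (-2 : ℝ)) : latticeFourierNorm γ ρ < ∞ := by
  have hβ : 1 < 2 - γ := by linarith
  have hbound (ξ : ℝ) : (1 + ‖ξ‖ₑ) ^ γ * ‖measureFourier ρ ξ‖ₑ ≤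
      C * (1 + ‖ξ‖ₑ) ^ (-(2 - γ)) := by
    rw [neg_sub, sub_eq_add_neg, ENNReal.rpow_add _ _ (by simp) (by simp), mul_left_comm]
    exact mul_le_mul_right (h ξ) _
  calc latticeFourierNorm γ ρ
      ≤ C * (2 ^ (2 - γ) * ∑' k : ℤ, (1 + ‖(k : ℝ)‖ₑ) ^ (-(2 - γ))) := by
        refine iSup_le fun ξ => (ENNReal.tsum_le_tsum fun k => hbound _).trans ?_
        rw [ENNReal.tsum_mul_left]
        exact mul_le_mul_right (tsum_one_add_enorm_sub_rpow_neg_le (by linarith) ξ) _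
    _ < ∞ := ENNReal.mul_lt_top ENNReal.coe_lt_top (ENNReal.mul_lt_top
        (ENNReal.rpow_lt_top_of_nonneg (by linarith) ENNReal.ofNat_ne_top)
        (tsum_one_add_enorm_rpow_neg_lt_top hβ))

theorem norm_measureFourier_restrict_Icc_le (ξ : ℝ) :
    (1 + |ξ|) * ‖measureFourier (volume.restrict (Icc 0 1)) ξ‖ ≤ 2 := by
  set z := measureFourier (volume.restrict (Icc 0 1)) ξ with hz
  have hz_le : ‖z‖ ≤ 1 := by
    simpa using norm_measureFourier_le (volume.restrict (Icc (0 : ℝ) 1)) ξ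
  rcases eq_or_ne ξ 0 with rfl | hξ
  · rw [abs_zero]; linarith
  set c : ℂ := ((-2 * Real.pi * ξ : ℝ) : ℂ) * Complex.I with hc
  have hc0 : c ≠ 0 := by simp [hc, Real.pi_ne_zero, hξ]
  have hcz : c * z = Complex.exp c - 1 := by
    have hint := integral_exp_mul_complex (a := 0) (b := 1) hc0
    rw [intervalIntegral.integral_of_le zero_le_one, ← integral_Icc_eq_integral_Ioc,
      Complex.ofReal_zero, Complex.ofReal_one, mul_zero, Complex.exp_zero, mul_one] at hint
    rw [eq_div_iff hc0, mul_comm] at hint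
    rw [← hint, hz, measureFourier]
    congr with x
    rw [hc]
    push_cast
    ring_nf
  have hnorm : 2 * Real.pi * |ξ| * ‖z‖ ≤ 2 := by
    have hnormc : ‖c‖ = 2 * Real.pi * |ξ| := by simp [hc, abs_of_pos Real.pi_pos]
    rw [← hnormc, ← norm_mul, hcz]
    refine (norm_sub_le _ _).trans ?_
    rw [hc, Complex.norm_exp_ofReal_mul_I, norm_one]
    norm_num
  nlinarith [Real.pi_gt_three, mul_nonneg (abs_nonneg ξ) (norm_nonneg z)]

theorem exists_measure_latticeFourierNorm_lt_top {γ : ℝ} (hγ : γ < 1) :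
    ∃ ρ : Measure ℝ, IsProbabilityMeasure ρ ∧ ρ (Icc 0 2)ᶜ = 0 ∧ latticeFourierNorm γ ρ < ∞ := by
  set τ : Measure ℝ := volume.restrict (Icc 0 1) with hτ
  have : IsProbabilityMeasure τ := ⟨by simp [hτ]⟩
  refine ⟨τ.conv τ, inferInstance, ?_, latticeFourierNorm_lt_top (C := 4) hγ fun ξ => ?_⟩
  · rw [Measure.conv, Measure.map_apply (by fun_prop) measurableSet_Icc.compl]
    have hmem : ∀ᵐ x ∂τ, x ∈ Icc (0 : ℝ) 1 := ae_restrict_mem measurableSet_Icc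
    refine measure_eq_zero_iff_ae_notMem.2 ?_
    filter_upwards [Measure.quasiMeasurePreserving_fst.ae hmem,
      Measure.quasiMeasurePreserving_snd.ae hmem] with p hp₁ hp₂ hp
    exact hp ⟨by linarith [hp₁.1, hp₂.1], by linarith [hp₁.2, hp₂.2]⟩
  · have hle : ‖measureFourier τ ξ‖ₑ ≤ 2 * (1 + ‖ξ‖ₑ)⁻¹ := by
      rw [← div_eq_mul_inv, ENNReal.le_div_iff_mul_le (by simp) (by simp), mul_comm]
      have h := ENNReal.ofReal_le_ofReal (norm_measureFourier_restrict_Icc_le ξ)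
      rwa [ENNReal.ofReal_mul (by positivity), ENNReal.ofReal_add zero_le_one (abs_nonneg ξ),
        ofReal_norm, ENNReal.ofReal_one, ← Real.enorm_eq_ofReal_abs, ENNReal.ofReal_ofNat] at h
    calc ‖measureFourier (τ.conv τ) ξ‖ₑ = ‖measureFourier τ ξ‖ₑ ^ 2 := by
          rw [measureFourier_eq_charFun, charFun_conv, ← measureFourier_eq_charFun, ← sq, enorm_pow]
      _ ≤ (2 * (1 + ‖ξ‖ₑ)⁻¹) ^ 2 := by gcongr
      _ = (4 : ℝ≥0) * (1 + ‖ξ‖ₑ) ^ (-2 : ℝ) := by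
          rw [mul_pow, ENNReal.rpow_neg, ← ENNReal.inv_pow, ENNReal.rpow_ofNat]
          norm_num

end SmoothMeasure

section PrimeTent

/-- The `1`-periodic tent of width `η` and mass `1` around the integers. -/
noncomputable def tent (η x : ℝ) : ℝ :=
  max 0 (η - ‖(x : UnitAddCircle)‖) / η ^ 2

theorem tent_nonneg (η x : ℝ) : 0 ≤ tent η x := by
  unfold tent
  positivity

theorem continuous_tent (η : ℝ) : Continuous (tent η) :=
  (continuous_const.max (continuous_const.sub (AddCircle.continuous_mk' 1).norm)).div_const _

theorem norm_le_of_tent_ne_zero {η x : ℝ} (h : tent η x ≠ 0) : ‖(x : UnitAddCircle)‖ ≤ η := by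
  contrapose! h
  rw [tent, max_eq_left (by linarith), zero_div]

theorem hasSum_inv_sq_mul_fourierChar {y : ℝ} (hy : y ∈ Icc 0 1) (n : ℤ) :
    HasSum (fun k : ℤ => 1 / (k : ℂ) ^ 2 * 𝐞 (k * (y + n)))
      ((2 * Real.pi ^ 2 * (y ^ 2 - |y| + 6⁻¹) : ℝ) : ℂ) := by
  have h := hasSum_one_div_pow_mul_fourier_mul_bernoulliFun (k := 2) le_rfl hy
  convert h using 1
  · ext k
    have hn : (𝐞 (k * n) : ℂ) = 1 := by
      rw [Real.fourierChar_apply, ← Complex.exp_int_mul_two_pi_mul_I (k * n)]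
      push_cast
      ring_nf
    rw [fourier_coe_apply, mul_add, AddChar.map_add_eq_mul, Circle.coe_mul, hn,
      Real.fourierChar_apply, mul_one]
    push_cast
    ring_nf
  · rw [bernoulliFun_two, abs_of_nonneg hy.1]
    push_cast
    rw [mul_pow, mul_pow, Complex.I_sq, Nat.factorial_two]
    push_cast
    ring

theorem hasSum_inv_sq_mul_fourierChar_of_abs_le {y : ℝ} (hy : |y| ≤ 1) (n : ℤ) :
    HasSum (fun k : ℤ => 1 / (k : ℂ) ^ 2 * 𝐞 (k * (y + n)))
      ((2 * Real.pi ^ 2 * (y ^ 2 - |y| + 6⁻¹) : ℝ) : ℂ) := by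
  rcases le_total 0 y with h0 | h0
  · exact hasSum_inv_sq_mul_fourierChar ⟨h0, (le_abs_self y).trans hy⟩ n
  · have hy1 : 0 ≤ y + 1 := by linarith [neg_abs_le y]
    have h := hasSum_inv_sq_mul_fourierChar ⟨hy1, by linarith⟩ (n - 1)
    convert h using 4
    · push_cast
      ring_nf
    · rw [abs_of_nonneg hy1, abs_of_nonpos h0]
      ring_nf

theorem fourierChar_add_fourierChar_neg (x : ℝ) :
    (𝐞 x + 𝐞 (-x) : ℂ) = ((2 - 4 * Real.sin (Real.pi * x) ^ 2 : ℝ) : ℂ) := by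
  have h : 2 - 4 * Real.sin (Real.pi * x) ^ 2 = 2 * Real.cos (2 * Real.pi * x) := by
    rw [mul_assoc, Real.cos_two_mul_eq_one_sub]
    ring
  rw [h, Complex.ofReal_mul, Complex.ofReal_cos, Complex.ofReal_ofNat, Complex.two_cos,
    Real.fourierChar_apply, Real.fourierChar_apply]
  push_cast
  ring_nf

theorem sinc_sq_mul_fourierChar {η : ℝ} (hη : η ≠ 0) {k : ℤ} (hk : k ≠ 0) (x : ℝ) :
    ((Real.sinc (Real.pi * k * η) ^ 2 : ℝ) : ℂ) * 𝐞 (k * x) =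
      (1 / (k : ℂ) ^ 2 * 𝐞 (k * x) - 1 / (k : ℂ) ^ 2 * 𝐞 (k * (x + η)) / 2 -
        1 / (k : ℂ) ^ 2 * 𝐞 (k * (x - η)) / 2) / (2 * Real.pi ^ 2 * η ^ 2 : ℝ) := by
  have hk' : (k : ℂ) ≠ 0 := Int.cast_ne_zero.2 hk
  have hη' : (η : ℂ) ≠ 0 := Complex.ofReal_ne_zero.2 hη
  have hπ : (Real.pi : ℂ) ≠ 0 := Complex.ofReal_ne_zero.2 Real.pi_ne_zero
  have hz : Real.pi * k * η ≠ 0 := by positivity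
  have hadd := fourierChar_add_fourierChar_neg (k * η)
  rw [← eq_sub_iff_add_eq'] at hadd
  rw [Real.sinc_of_ne_zero hz, mul_add, mul_sub, sub_eq_add_neg (k * x), AddChar.map_add_eq_mul,
    AddChar.map_add_eq_mul, Circle.coe_mul, Circle.coe_mul, hadd]
  push_cast
  field_simp
  ring

-- The tent is a second difference of the Bernoulli series `∑ k⁻² e(k x)`.
theorem hasSum_tent {η : ℝ} (h0 : 0 < η) (h1 : η ≤ 1 / 2) (x : ℝ) :
    HasSum (fun k : ℤ => ((Real.sinc (Real.pi * k * η) ^ 2 : ℝ) : ℂ) * 𝐞 (k * x)) (tent η x) := by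
  set y := x - round x with hy
  have hy2 : |y| ≤ 1 / 2 := abs_sub_round x
  have hsum {t : ℝ} (ht : |t| ≤ 1 / 2) : HasSum (fun k : ℤ => 1 / (k : ℂ) ^ 2 * 𝐞 (k * (x + t)))
      ((2 * Real.pi ^ 2 * ((y + t) ^ 2 - |y + t| + 6⁻¹) : ℝ) : ℂ) := by
    have hyt : |y + t| ≤ 1 := by linarith [abs_add_le y t]
    have hxt : x + t = (y + t : ℝ) + round x := by linarith
    simpa only [← Complex.ofReal_add, ← Complex.ofReal_mul, hxt] using
      hasSum_inv_sq_mul_fourierChar_of_abs_le hyt (round x)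
  have hη : |η| ≤ 1 / 2 := by rwa [abs_of_pos h0]
  have hcomb := (((hsum (t := 0) (by norm_num)).sub ((hsum hη).div_const 2)).sub
    ((hsum (t := -η) (by rwa [abs_neg])).div_const 2)).div_const (2 * Real.pi ^ 2 * η ^ 2 : ℝ)
  convert (hasSum_ite_eq (0 : ℤ) (1 : ℂ)).add hcomb using 1
  · ext k
    rcases eq_or_ne k 0 with rfl | hk
    · simp
    · rw [sinc_sq_mul_fourierChar h0.ne' hk, if_neg hk, zero_add, add_zero, sub_eq_add_neg x]
  · have htent : tent η x = 1 + (y ^ 2 - |y| + 6⁻¹ - ((y + η) ^ 2 - |y + η| + 6⁻¹) / 2 -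
        ((y - η) ^ 2 - |y - η| + 6⁻¹) / 2) / η ^ 2 := by
      rw [tent, UnitAddCircle.norm_eq, ← hy]
      field_simp
      grind
    rw [htent, add_zero, ← sub_eq_add_neg]
    have hη' : (η : ℂ) ≠ 0 := Complex.ofReal_ne_zero.2 h0.ne'
    have hπ : (Real.pi : ℂ) ≠ 0 := Complex.ofReal_ne_zero.2 Real.pi_ne_zero
    push_cast
    field_simp

end PrimeTent

section PrimeTentSeries

/-- The average over the primes `p ≤ M` of the dilated tents `x ↦ tent η (p x)`. -/
noncomputable def primeTent (M : ℕ) (η x : ℝ) : ℝ :=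
  (∑ p ∈ Nat.primesLE M, tent η (p * x)) / (Nat.primesLE M).card

/-- The `k`-th Fourier coefficient of `primeTent M η`. -/
noncomputable def primeTentCoeff (M : ℕ) (η : ℝ) (k : ℤ) : ℝ :=
  (∑ p ∈ (Nat.primesLE M).filter fun p : ℕ => (p : ℤ) ∣ k,
      Real.sinc (Real.pi * (k / p : ℤ) * η) ^ 2) / (Nat.primesLE M).card

theorem hasSum_tent_mul {η : ℝ} (h0 : 0 < η) (h1 : η ≤ 1 / 2) {p : ℕ} (hp : p ≠ 0) (x : ℝ) :
    HasSum (fun k : ℤ => ((if (p : ℤ) ∣ k then Real.sinc (Real.pi * (k / p : ℤ) * η) ^ 2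
      else 0 : ℝ) : ℂ) * 𝐞 (k * x)) (tent η (p * x)) := by
  have hp' : (p : ℤ) ≠ 0 := Int.natCast_ne_zero.2 hp
  have hinj : Function.Injective fun k : ℤ => (p : ℤ) * k := mul_right_injective₀ hp'
  rw [← hinj.hasSum_iff]
  · refine (hasSum_tent h0 h1 (p * x)).congr_fun fun k => ?_
    simp only [Function.comp_apply, dvd_mul_right, if_true, Int.mul_ediv_cancel_left _ hp']
    push_cast
    rw [mul_comm (p : ℝ), mul_assoc (k : ℝ)]
  · rintro k hk
    rw [if_neg fun ⟨c, hc⟩ => hk ⟨c, hc.symm⟩, Complex.ofReal_zero, zero_mul]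

theorem hasSum_primeTent {η : ℝ} (h0 : 0 < η) (h1 : η ≤ 1 / 2) (M : ℕ) (x : ℝ) :
    HasSum (fun k : ℤ => (primeTentCoeff M η k : ℂ) * 𝐞 (k * x)) (primeTent M η x) := by
  have h := (hasSum_sum (s := Nat.primesLE M) fun p hp => hasSum_tent_mul h0 h1
    (Nat.prime_of_mem_primesLE hp).ne_zero x).div_const ((Nat.primesLE M).card : ℂ)
  rw [primeTent, Complex.ofReal_div, Complex.ofReal_sum, Complex.ofReal_natCast]
  refine h.congr_fun fun k => ?_
  rw [← Finset.sum_mul, primeTentCoeff, Finset.sum_filter, Complex.ofReal_div,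
    Complex.ofReal_sum, Complex.ofReal_natCast, div_mul_eq_mul_div]

theorem continuous_primeTent (M : ℕ) (η : ℝ) : Continuous (primeTent M η) :=
  (continuous_finsetSum _ fun _ _ =>
    (continuous_tent η).comp (continuous_const.mul continuous_id)).div_const _

theorem primeTent_nonneg (M : ℕ) (η x : ℝ) : 0 ≤ primeTent M η x :=
  div_nonneg (Finset.sum_nonneg fun _ _ => tent_nonneg _ _) (Nat.cast_nonneg _)

theorem primeTentCoeff_zero {M : ℕ} (hM : 2 ≤ M) (η : ℝ) : primeTentCoeff M η 0 = 1 := by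
  have hcard : ((Nat.primesLE M).card : ℝ) ≠ 0 :=
    Nat.cast_ne_zero.2 (Finset.card_ne_zero_of_mem (Nat.mem_primesLE.2 ⟨hM, Nat.prime_two⟩))
  simp only [primeTentCoeff, dvd_zero, Finset.filter_true, Int.zero_ediv, Int.cast_zero, mul_zero,
    zero_mul, Real.sinc_zero, one_pow, Finset.sum_const, nsmul_eq_mul, mul_one, div_self hcard]

theorem primeTentCoeff_nonneg (M : ℕ) (η : ℝ) (k : ℤ) : 0 ≤ primeTentCoeff M η k :=
  div_nonneg (Finset.sum_nonneg fun _ _ => sq_nonneg _) (Nat.cast_nonneg _)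

/-- The points `x` such that `p x` is `η`-close to an integer for some prime `p ≤ M`. -/
def primeNeighborhood (M : ℕ) (η : ℝ) : Set ℝ :=
  {x | ∃ p ∈ Nat.primesLE M, ‖((p * x : ℝ) : UnitAddCircle)‖ ≤ η}

theorem mem_primeNeighborhood_of_primeTent_ne_zero {M : ℕ} {η x : ℝ} (h : primeTent M η x ≠ 0) :
    x ∈ primeNeighborhood M η := by
  obtain ⟨p, hp, hne⟩ := Finset.exists_ne_zero_of_sum_ne_zero (div_ne_zero_iff.1 h).1
  exact ⟨p, hp, norm_le_of_tent_ne_zero hne⟩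

theorem isClosed_primeNeighborhood (M : ℕ) (η : ℝ) : IsClosed (primeNeighborhood M η) := by
  have h : primeNeighborhood M η =
      ⋃ p ∈ Nat.primesLE M, {x | ‖((p * x : ℝ) : UnitAddCircle)‖ ≤ η} := by
    ext x
    simp only [primeNeighborhood, mem_ofPred_eq, mem_iUnion, exists_prop]
  rw [h]
  exact (Finset.finite_toSet _).isClosed_biUnion fun p _ => isClosed_le
    ((AddCircle.continuous_mk' 1).comp (continuous_const.mul continuous_id)).norm continuous_const

end PrimeTentSeries

section PrimeTentCoeff

theorem abs_sinc_le_inv_abs {x : ℝ} (hx : x ≠ 0) : |Real.sinc x| ≤ |x|⁻¹ := by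
  rw [Real.sinc_of_ne_zero hx, abs_div, div_eq_mul_inv]
  exact mul_le_of_le_one_left (by positivity) (Real.abs_sin_le_one x)

theorem sinc_sq_le_rpow_neg {x s : ℝ} (hx : x ≠ 0) (h0 : 0 ≤ s) (h2 : s ≤ 2) :
    Real.sinc x ^ 2 ≤ |x| ^ (-s) := by
  have hx' : 0 < |x| := abs_pos.2 hx
  rw [← sq_abs]
  rcases le_total 1 |x| with h | h
  · calc |Real.sinc x| ^ 2 ≤ (|x|⁻¹) ^ 2 := by gcongr; exact abs_sinc_le_inv_abs hx
      _ = |x| ^ (-2 : ℝ) := by rw [Real.rpow_neg hx'.le, Real.rpow_two, inv_pow]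
      _ ≤ |x| ^ (-s) := Real.rpow_le_rpow_of_exponent_le h (neg_le_neg h2)
  · calc |Real.sinc x| ^ 2 ≤ 1 := pow_le_one₀ (abs_nonneg _) (Real.abs_sinc_le_one x)
      _ ≤ |x| ^ (-s) := Real.one_le_rpow_of_pos_of_le_one_of_nonpos hx' h (neg_nonpos.2 h0)

theorem card_primesLE_filter_dvd_le (M : ℕ) {k : ℤ} (hk : k ≠ 0) {κ : ℝ} (hκ : 0 < κ) :
    (((Nat.primesLE M).filter fun p : ℕ => (p : ℤ) ∣ k).card : ℝ) ≤
      |(k : ℝ)| ^ κ / (κ * Real.log 2) := by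
  set S := (Nat.primesLE M).filter fun p : ℕ => (p : ℤ) ∣ k with hS
  have hk' : k.natAbs ≠ 0 := Int.natAbs_ne_zero.2 hk
  have hsub : S ⊆ k.natAbs.primeFactors := by
    intro p hp
    rw [hS, Finset.mem_filter] at hp
    exact Nat.mem_primeFactors.2 ⟨Nat.prime_of_mem_primesLE hp.1, Int.natCast_dvd.1 hp.2, hk'⟩
  have hpow : 2 ^ S.card ≤ k.natAbs := by
    calc 2 ^ S.card ≤ ∏ p ∈ S, p := Finset.pow_card_le_prod _ _ _ fun p hp =>
          (Nat.prime_of_mem_primesLE (Finset.mem_filter.1 hp).1).two_le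
      _ ≤ ∏ p ∈ k.natAbs.primeFactors, p := Finset.prod_le_prod_of_subset_of_one_le' hsub
          fun p hp _ => (Nat.prime_of_mem_primeFactors hp).one_le
      _ ≤ k.natAbs := Nat.le_of_dvd (Nat.pos_of_ne_zero hk') (Nat.prod_primeFactors_dvd _)
  have hlog : S.card * Real.log 2 ≤ Real.log |(k : ℝ)| := by
    rw [← Real.log_pow, ← Int.cast_abs, Int.abs_eq_natAbs]
    exact Real.log_le_log (by positivity) (by exact_mod_cast hpow)
  rw [← div_div, le_div_iff₀ (Real.log_pos one_lt_two)]
  exact hlog.trans (Real.log_le_rpow_div (abs_nonneg _) hκ)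

theorem sinc_sq_le_of_dvd {M p : ℕ} (hp0 : p ≠ 0) (hpM : p ≤ M) {η : ℝ} (hη : 0 < η) {k : ℤ}
    (hk : k ≠ 0) (hpk : (p : ℤ) ∣ k) {s : ℝ} (h0 : 0 ≤ s) (h2 : s ≤ 2) :
    Real.sinc (Real.pi * (k / p : ℤ) * η) ^ 2 ≤ (M / η / |(k : ℝ)|) ^ s := by
  obtain ⟨c, rfl⟩ := hpk
  have hc : c ≠ 0 := right_ne_zero_of_mul hk
  have : 0 < |(c : ℝ)| := by positivity
  rw [Int.mul_ediv_cancel_left _ (Int.natCast_ne_zero.2 hp0)]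
  refine (sinc_sq_le_rpow_neg (by positivity) h0 h2).trans ?_
  rw [Real.rpow_neg (abs_nonneg _), ← Real.inv_rpow (abs_nonneg _)]
  push_cast
  rw [abs_mul, abs_mul, abs_mul, Nat.abs_cast, abs_of_pos Real.pi_pos, abs_of_pos hη]
  gcongr
  rw [inv_eq_one_div, div_div, div_le_div_iff₀ (by positivity) (by positivity)]
  calc 1 * (η * (p * |(c : ℝ)|)) ≤ Real.pi * (η * (M * |(c : ℝ)|)) := by
        gcongr
        linarith [Real.pi_gt_three]
    _ = M * (Real.pi * |(c : ℝ)| * η) := by ring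

theorem primeTentCoeff_le {M : ℕ} {η : ℝ} (hη : 0 < η) {k : ℤ} (hk : k ≠ 0) {γ κ : ℝ}
    (hγ : 0 ≤ γ) (hκ : 0 < κ) (hγκ : γ + κ ≤ 2) :
    primeTentCoeff M η k ≤
      (M / η) ^ (γ + κ) / (Nat.primesLE M).card / (κ * Real.log 2) * |(k : ℝ)| ^ (-γ) := by
  have hk0 : 0 < |(k : ℝ)| := by positivity
  calc primeTentCoeff M η k
      ≤ (|(k : ℝ)| ^ κ / (κ * Real.log 2)) * (M / η / |(k : ℝ)|) ^ (γ + κ) /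
          (Nat.primesLE M).card := by
        refine div_le_div_of_nonneg_right ?_ (Nat.cast_nonneg _)
        calc _ ≤ ((Nat.primesLE M).filter fun p : ℕ => (p : ℤ) ∣ k).card •
                (M / η / |(k : ℝ)|) ^ (γ + κ) := Finset.sum_le_card_nsmul _ _ _ fun p hp => by
              obtain ⟨hpM, hpk⟩ := Finset.mem_filter.1 hp
              exact sinc_sq_le_of_dvd (Nat.prime_of_mem_primesLE hpM).ne_zero
                (Nat.le_of_mem_primesLE hpM) hη hk hpk (by positivity) hγκ
          _ ≤ _ := by
              rw [nsmul_eq_mul]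
              gcongr
              exact card_primesLE_filter_dvd_le M hk hκ
    _ = _ := by
        have hκ0 : |(k : ℝ)| ^ κ ≠ 0 := (Real.rpow_pos_of_pos hk0 _).ne'
        rw [Real.div_rpow (by positivity) hk0.le, Real.rpow_add hk0, Real.rpow_neg hk0.le]
        field_simp

/-- The number which bounds `(1 + |k|) ^ γ` times the nonzero Fourier coefficients of
`primeTent M η`, when the divisor bound is applied with exponent `κ`. -/
noncomputable def primeTentBound (M : ℕ) (η γ κ : ℝ) : ℝ :=
  2 ^ γ * ((M / η) ^ (γ + κ) / (Nat.primesLE M).card / (κ * Real.log 2))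

theorem rpow_mul_enorm_primeTentCoeff_le {M : ℕ} {η : ℝ} (hη : 0 < η) {k : ℤ} (hk : k ≠ 0)
    {γ κ : ℝ} (hγ : 0 ≤ γ) (hκ : 0 < κ) (hγκ : γ + κ ≤ 2) :
    (1 + ‖(k : ℝ)‖ₑ) ^ γ * ‖(primeTentCoeff M η k : ℂ)‖ₑ ≤
      ENNReal.ofReal (primeTentBound M η γ κ) := by
  have hk1 : 1 ≤ |(k : ℝ)| := by exact_mod_cast Int.one_le_abs hk
  have : 0 < |(k : ℝ)| ^ γ := Real.rpow_pos_of_pos (by linarith) _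
  have hone : (1 + ‖(k : ℝ)‖ₑ) ^ γ = ENNReal.ofReal ((1 + |(k : ℝ)|) ^ γ) := by
    rw [← ENNReal.ofReal_rpow_of_nonneg (by positivity) hγ,
      ENNReal.ofReal_add zero_le_one (abs_nonneg _), ENNReal.ofReal_one, Real.enorm_eq_ofReal_abs]
  rw [hone, ← ofReal_norm, Complex.norm_real, Real.norm_of_nonneg
    (primeTentCoeff_nonneg M η k), ← ENNReal.ofReal_mul (by positivity)]
  refine ENNReal.ofReal_le_ofReal ?_
  calc (1 + |(k : ℝ)|) ^ γ * primeTentCoeff M η k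
      ≤ (2 * |(k : ℝ)|) ^ γ * ((M / η) ^ (γ + κ) / (Nat.primesLE M).card / (κ * Real.log 2) *
          |(k : ℝ)| ^ (-γ)) := by
        gcongr
        · exact primeTentCoeff_nonneg M η k
        · linarith
        · exact primeTentCoeff_le hη hk hγ hκ hγκ
    _ = primeTentBound M η γ κ := by
        rw [primeTentBound, Real.mul_rpow zero_le_two (abs_nonneg _),
          Real.rpow_neg (abs_nonneg _)]
        field_simp

theorem tsum_rpow_mul_enorm_primeTentCoeff_lt_top (M : ℕ) {η : ℝ} (hη : 0 < η) :
    ∑' k : ℤ, (1 + ‖(k : ℝ)‖ₑ) ^ (1 / 2 : ℝ) * ‖(primeTentCoeff M η k : ℂ)‖ₑ < ∞ := by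
  set B := ENNReal.ofReal (primeTentBound M η (7 / 4) (1 / 4)) + ‖(primeTentCoeff M η 0 : ℂ)‖ₑ
  have hterm (k : ℤ) : (1 + ‖(k : ℝ)‖ₑ) ^ (1 / 2 : ℝ) * ‖(primeTentCoeff M η k : ℂ)‖ₑ ≤
      B * (1 + ‖(k : ℝ)‖ₑ) ^ (-(5 / 4) : ℝ) := by
    rcases eq_or_ne k 0 with rfl | hk
    · simp only [Int.cast_zero, enorm_zero, add_zero, ENNReal.one_rpow, one_mul, mul_one]
      exact le_add_self
    · have hsplit : (1 + ‖(k : ℝ)‖ₑ) ^ (1 / 2 : ℝ) =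
          (1 + ‖(k : ℝ)‖ₑ) ^ (7 / 4 : ℝ) * (1 + ‖(k : ℝ)‖ₑ) ^ (-(5 / 4) : ℝ) := by
        rw [← ENNReal.rpow_add _ _ (by simp) (by simp)]
        norm_num
      rw [hsplit, mul_right_comm]
      gcongr
      exact (rpow_mul_enorm_primeTentCoeff_le hη hk (by norm_num) (by norm_num)
        (by norm_num)).trans le_self_add
  calc _ ≤ ∑' k : ℤ, B * (1 + ‖(k : ℝ)‖ₑ) ^ (-(5 / 4) : ℝ) := ENNReal.tsum_le_tsum hterm
    _ = B * ∑' k : ℤ, (1 + ‖(k : ℝ)‖ₑ) ^ (-(5 / 4) : ℝ) := ENNReal.tsum_mul_left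
    _ < ∞ := ENNReal.mul_lt_top (by simp [B])
      (tsum_one_add_enorm_rpow_neg_lt_top (by norm_num))

theorem summable_primeTentCoeff (M : ℕ) {η : ℝ} (hη : 0 < η) :
    Summable fun k : ℤ => (primeTentCoeff M η k : ℂ) := by
  refine (tsum_enorm_ne_top_iff_summable_norm.1 (ne_top_of_le_ne_top
    (tsum_rpow_mul_enorm_primeTentCoeff_lt_top M hη).ne ?_)).of_norm
  exact ENNReal.tsum_le_tsum fun k =>
    le_mul_of_one_le_left' (ENNReal.one_le_rpow le_self_add (by norm_num))

end PrimeTentCoeff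

section SalemScale

theorem eventually_half_mul_le_card_primesLE_mul_log :
    ∀ᶠ M : ℕ in atTop, (M / 2 : ℝ) ≤ (Nat.primesLE M).card * Real.log M := by
  have hlog : ∀ᶠ M : ℕ in atTop, ‖Real.log ((M + 1 : ℕ) : ℝ)‖ ≤ 1 / 8 * ‖((M + 1 : ℕ) : ℝ)‖ :=
    (tendsto_natCast_atTop_atTop.comp (tendsto_add_atTop_nat 1)).eventually
      (Real.isLittleO_log_id_atTop.def (by norm_num))
  filter_upwards [hlog, eventually_ge_atTop 2] with M hlog hM
  have hM' : (2 : ℝ) ≤ M := by exact_mod_cast hM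
  have hpi := Chebyshev.pi_ge M
  rw [← Nat.primesLE_card_eq_primeCounting, div_le_iff₀ (Real.log_pos (by linarith))] at hpi
  push_cast at hlog
  rw [Real.norm_of_nonneg (Real.log_nonneg (by linarith)), Real.norm_of_nonneg (by positivity)]
    at hlog
  nlinarith [Real.log_two_gt_d9]

theorem tendsto_rpow_div_card_primesLE {q : ℝ} (hq : q < 1) :
    Tendsto (fun M : ℕ => (M : ℝ) ^ q / (Nat.primesLE M).card) atTop (𝓝 0) := by
  have hlim : Tendsto (fun M : ℕ => 2 * (Real.log M / (M : ℝ) ^ (1 - q))) atTop (𝓝 0) := by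
    simpa only [mul_zero, Function.comp_def] using ((isLittleO_log_rpow_atTop
      (sub_pos.2 hq)).tendsto_div_nhds_zero.comp tendsto_natCast_atTop_atTop).const_mul 2
  refine squeeze_zero' (.of_forall fun M => by positivity) ?_ hlim
  filter_upwards [eventually_half_mul_le_card_primesLE_mul_log, eventually_ge_atTop 2] with M hM hM2
  have hM0 : (0 : ℝ) < M := by positivity
  have hcard : (0 : ℝ) < (Nat.primesLE M).card :=
    Nat.cast_pos.2 (Finset.card_pos.2 ⟨2, Nat.mem_primesLE.2 ⟨hM2, Nat.prime_two⟩⟩)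
  rw [← mul_div_assoc, div_le_div_iff₀ hcard (by positivity), ← Real.rpow_add hM0,
    add_sub_cancel, Real.rpow_one]
  linarith

/-- The scale `η = M ^ (1 - 2 / α)`, for which the intersection of the prime neighbourhoods along a
sparse sequence of `M` has dimension `α`. -/
noncomputable def salemScale (α : ℝ) (M : ℕ) : ℝ := (M : ℝ) ^ (1 - 2 / α)

theorem salemScale_pos (α : ℝ) {M : ℕ} (hM : 0 < M) : 0 < salemScale α M :=
  Real.rpow_pos_of_pos (Nat.cast_pos.2 hM) _

theorem salemScale_le_half {α : ℝ} (hα0 : 0 < α) (hα1 : α ≤ 1) {M : ℕ} (hM : 2 ≤ M) :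
    salemScale α M ≤ 1 / 2 := by
  have hM' : (2 : ℝ) ≤ M := by exact_mod_cast hM
  have h2 : 2 ≤ 2 / α := by rw [le_div_iff₀ hα0]; linarith
  calc salemScale α M ≤ (M : ℝ) ^ (-1 : ℝ) :=
        Real.rpow_le_rpow_of_exponent_le (by linarith) (by linarith)
    _ = 1 / M := by rw [Real.rpow_neg_one, one_div]
    _ ≤ 1 / 2 := by gcongr

theorem tendsto_primeTentBound_salemScale {α γ κ : ℝ} (hα : 0 < α) (h : γ + κ < α / 2) :
    Tendsto (fun M : ℕ => primeTentBound M (salemScale α M) γ κ) atTop (𝓝 0) := by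
  have hq : 2 / α * (γ + κ) < 1 := by
    calc 2 / α * (γ + κ) < 2 / α * (α / 2) := by gcongr
      _ = 1 := by field_simp
  have hlim := ((tendsto_rpow_div_card_primesLE hq).div_const (κ * Real.log 2)).const_mul (2 ^ γ)
  rw [zero_div, mul_zero] at hlim
  refine hlim.congr' ?_
  filter_upwards [eventually_gt_atTop 0] with M hM
  have hM0 : (0 : ℝ) < M := Nat.cast_pos.2 hM
  have hscale : M / salemScale α M = (M : ℝ) ^ (2 / α) := by
    rw [salemScale, Real.rpow_sub hM0, Real.rpow_one, div_div_cancel₀ hM0.ne']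
  rw [primeTentBound, hscale, ← Real.rpow_mul hM0.le]

end SalemScale

section Sieve

/-- A finite measure on `[0, 2]` which can be sieved: the Fourier estimates for its prime-tent
densities are governed by its lattice Fourier norm of order `1 / 2`. -/
structure IsSievable (ρ : Measure ℝ) : Prop where
  isFiniteMeasure : IsFiniteMeasure ρ
  measure_compl : ρ (Icc 0 2)ᶜ = 0
  latticeFourierNorm_lt_top : latticeFourierNorm (1 / 2) ρ < ∞

theorem withDensity_compl_eq_zero {ρ : Measure ℝ} {F : ℝ → ℝ} {A : Set ℝ}
    (hA : MeasurableSet A) (hF : ∀ x, F x ≠ 0 → x ∈ A) :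
    ρ.withDensity (fun x => ENNReal.ofReal (F x)) Aᶜ = 0 := by
  rw [withDensity_apply _ hA.compl, setLIntegral_congr_fun hA.compl fun x hx => ?_, lintegral_zero]
  rw [not_imp_comm.1 (hF x) hx, ENNReal.ofReal_zero]

theorem IsSievable.withDensity_primeTent {ρ : Measure ℝ} (hρ : IsSievable ρ) {M : ℕ} {η : ℝ}
    (h0 : 0 < η) (h1 : η ≤ 1 / 2) :
    IsSievable (ρ.withDensity fun x => ENNReal.ofReal (primeTent M η x)) where
  isFiniteMeasure :=
    have := hρ.isFiniteMeasure
    isFiniteMeasure_withDensity_of_hasSum (continuous_primeTent M η).measurable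
      (summable_primeTentCoeff M h0) (hasSum_primeTent h0 h1 M)
  measure_compl := withDensity_absolutelyContinuous _ _ hρ.measure_compl
  latticeFourierNorm_lt_top :=
    have := hρ.isFiniteMeasure
    (latticeFourierNorm_withDensity_le (by norm_num) (continuous_primeTent M η).measurable
      (primeTent_nonneg M η) (summable_primeTentCoeff M h0) (hasSum_primeTent h0 h1 M)).trans_lt
      (ENNReal.mul_lt_top (tsum_rpow_mul_enorm_primeTentCoeff_lt_top M h0)
        hρ.latticeFourierNorm_lt_top)

theorem IsSievable.exists_sieve {α γ : ℝ} (hα0 : 0 < α) (hα1 : α ≤ 1) (hγ0 : 0 ≤ γ)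
    (hγ : γ < α / 2) {ε : ℝ≥0∞} (hε : 0 < ε) {ρ : Measure ℝ} (hρ : IsSievable ρ) (N : ℕ) :
    ∃ M ≥ N, ∃ ρ' : Measure ℝ, IsSievable ρ' ∧ ρ' ≪ ρ ∧
      ρ' (primeNeighborhood M (salemScale α M))ᶜ = 0 ∧
      ∀ ξ : ℝ, (1 + ‖ξ‖ₑ) ^ γ * ‖measureFourier ρ' ξ - measureFourier ρ ξ‖ₑ ≤ ε := by
  obtain ⟨κ, hκ0, hκ⟩ := exists_between (sub_pos.2 hγ)
  have hL : latticeFourierNorm γ ρ ≠ ∞ :=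
    ((latticeFourierNorm_mono (by linarith) ρ).trans_lt hρ.latticeFourierNorm_lt_top).ne
  have hlim : Tendsto (fun M : ℕ => ENNReal.ofReal (primeTentBound M (salemScale α M) γ κ) *
      latticeFourierNorm γ ρ) atTop (𝓝 0) := by
    simpa only [ENNReal.ofReal_zero, zero_mul] using ENNReal.Tendsto.mul_const
      (ENNReal.tendsto_ofReal (tendsto_primeTentBound_salemScale hα0 (by linarith))) (Or.inr hL)
  obtain ⟨M, hM, hMN, hM2⟩ := ((hlim.eventually_le_const hε).and
    ((eventually_ge_atTop N).and (eventually_ge_atTop 2))).exists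
  have hη0 : 0 < salemScale α M := salemScale_pos α (by positivity)
  have hη1 : salemScale α M ≤ 1 / 2 := salemScale_le_half hα0 hα1 hM2
  have := hρ.isFiniteMeasure
  refine ⟨M, hMN, _, hρ.withDensity_primeTent hη0 hη1, withDensity_absolutelyContinuous _ _,
    withDensity_compl_eq_zero (isClosed_primeNeighborhood M _).measurableSet fun _ =>
      mem_primeNeighborhood_of_primeTent_ne_zero, fun ξ => ?_⟩
  refine (rpow_mul_enorm_measureFourier_withDensity_sub_le hγ0 (continuous_primeTent M _).measurable
    (primeTent_nonneg M _) (summable_primeTentCoeff M hη0) (hasSum_primeTent hη0 hη1 M) ?_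
    (fun k hk => rpow_mul_enorm_primeTentCoeff_le hη0 hk hγ0 hκ0 (by linarith)) ξ).trans hM
  rw [primeTentCoeff_zero hM2, Complex.ofReal_one]

/-- A sequence of measures in which `ρ (j + 1)` lives on the prime neighbourhood of level `M j` and
arises from `ρ j` by a change of the Fourier transform of size `ε j * (1 + |ξ|) ^ (-γ j)`. -/
structure IsSieveSequence (α : ℝ) (γ : ℕ → ℝ) (ε : ℕ → ℝ≥0∞) (ρ : ℕ → Measure ℝ) (M : ℕ → ℕ) :
    Prop where
  isSievable (j : ℕ) : IsSievable (ρ j)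
  isProbabilityMeasure_zero : IsProbabilityMeasure (ρ 0)
  le_level (j : ℕ) : j ≤ M j
  absolutelyContinuous_succ (j : ℕ) : ρ (j + 1) ≪ ρ j
  measure_compl_succ (j : ℕ) : ρ (j + 1) (primeNeighborhood (M j) (salemScale α (M j)))ᶜ = 0
  enorm_sub_le (j : ℕ) (ξ : ℝ) :
    (1 + ‖ξ‖ₑ) ^ γ j * ‖measureFourier (ρ (j + 1)) ξ - measureFourier (ρ j) ξ‖ₑ ≤ ε j

theorem exists_isSieveSequence {α : ℝ} (hα0 : 0 < α) (hα1 : α ≤ 1) {γ : ℕ → ℝ}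
    (hγ0 : ∀ j, 0 ≤ γ j) (hγ : ∀ j, γ j < α / 2) {ε : ℕ → ℝ≥0∞} (hε : ∀ j, 0 < ε j) :
    ∃ ρ M, IsSieveSequence α γ ε ρ M := by
  obtain ⟨ρ₀, hρ₀, hsupp, hnorm⟩ := exists_measure_latticeFourierNorm_lt_top (γ := 1 / 2)
    (by norm_num)
  choose level hlevel next hnext hac hnull hdiff using fun (j : ℕ) (ρ : {ρ // IsSievable ρ}) =>
    ρ.2.exists_sieve hα0 hα1 (hγ0 j) (hγ j) (hε j) j
  let ρ (j : ℕ) : {ρ // IsSievable ρ} :=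
    Nat.rec ⟨ρ₀, inferInstance, hsupp, hnorm⟩ (fun j ρ => ⟨next j ρ, hnext j ρ⟩) j
  refine ⟨fun j => (ρ j).1, fun j => level j (ρ j), ?_⟩
  exact ⟨fun j => (ρ j).2, hρ₀, fun j => hlevel j _, fun j => hac j (ρ j),
    fun j => hnull j (ρ j), fun j => hdiff j (ρ j)⟩

namespace IsSieveSequence

variable {α : ℝ} {γ : ℕ → ℝ} {ε : ℕ → ℝ≥0∞} {ρ : ℕ → Measure ℝ} {M : ℕ → ℕ}

theorem absolutelyContinuous (h : IsSieveSequence α γ ε ρ M) {i j : ℕ} (hij : i ≤ j) :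
    ρ j ≪ ρ i := by
  induction j, hij using Nat.le_induction with
  | base => exact Measure.AbsolutelyContinuous.rfl
  | succ j _ ih => exact (h.absolutelyContinuous_succ j).trans ih

theorem edist_measureFourier_le (h : IsSieveSequence α γ ε ρ M) {β : ℝ} {i j : ℕ}
    (hβ : ∀ k ≥ i, β ≤ γ k) (hij : i ≤ j) (ξ : ℝ) :
    edist (measureFourier (ρ i) ξ) (measureFourier (ρ j) ξ) ≤
      (∑' k, ε k) * (1 + ‖ξ‖ₑ) ^ (-β) := by
  have hstep {k : ℕ} (hik : i ≤ k) (_ : k < j) :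
      edist (measureFourier (ρ k) ξ) (measureFourier (ρ (k + 1)) ξ) ≤
        ε k * (1 + ‖ξ‖ₑ) ^ (-β) := by
    rw [edist_comm, edist_eq_enorm_sub, ENNReal.rpow_neg, ← div_eq_mul_inv,
      ENNReal.le_div_iff_mul_le (Or.inl (by simp)) (Or.inl (by simp)), mul_comm]
    refine le_trans ?_ (h.enorm_sub_le k ξ)
    gcongr
    exacts [le_self_add, hβ k hik]
  calc _ ≤ ∑ k ∈ Finset.Ico i j, ε k * (1 + ‖ξ‖ₑ) ^ (-β) :=
        edist_le_Ico_sum_of_edist_le hij hstep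
    _ = (∑ k ∈ Finset.Ico i j, ε k) * (1 + ‖ξ‖ₑ) ^ (-β) := (Finset.sum_mul _ _ _).symm
    _ ≤ _ := by gcongr; exact ENNReal.sum_le_tsum _

end IsSieveSequence

end Sieve

section WeakLimit

theorem measureFourier_zero (μ : Measure ℝ) : measureFourier μ 0 = (μ.real univ : ℂ) := by
  simp [measureFourier]

theorem exists_tendsto_measureFourier {K : Set ℝ} (hK : IsCompact K) {ρ : ℕ → Measure ℝ}
    [∀ j, IsFiniteMeasure (ρ j)] {c : ℝ≥0} (hc : ∀ j, ρ j univ ≤ c) (hρ : ∀ j, ρ j Kᶜ = 0) :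
    ∃ (L : Ultrafilter ℕ) (ν : Measure ℝ), (L : Filter ℕ) ≤ atTop ∧ IsFiniteMeasure ν ∧
      (∀ ξ, Tendsto (fun j => measureFourier (ρ j) ξ) L (𝓝 (measureFourier ν ξ))) ∧
      ∀ E : Set ℝ, IsCompact E → (∀ᶠ j in atTop, ρ j Eᶜ = 0) → ν Eᶜ = 0 := by
  let σ : ℕ → FiniteMeasure ℝ := fun j => ⟨ρ j, inferInstance⟩
  let X (E : Set ℝ) : Set (FiniteMeasure ℝ) := {μ | μ.mass ≤ c ∧ μ Eᶜ = 0}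
  have hX {E : Set ℝ} (hE : IsCompact E) : IsCompact (X E) :=
    isCompact_setOfPred_finiteMeasure_le_of_isCompact c hE
  have hσ {E : Set ℝ} {j : ℕ} (h : ρ j Eᶜ = 0) : σ j ∈ X E :=
    ⟨ENNReal.coe_le_coe.1 ((FiniteMeasure.ennreal_mass).trans_le (hc j)),
      (FiniteMeasure.null_iff_toMeasure_null _ _).2 h⟩
  let L : Ultrafilter ℕ := Ultrafilter.of atTop
  have hL : (L : Filter ℕ) ≤ atTop := Ultrafilter.of_le _
  obtain ⟨ν, -, hν⟩ := (hX hK).ultrafilter_le_nhds (L.map σ)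
    (le_principal_iff.2 (mem_map.2 (univ_mem' fun j => hσ (hρ j))))
  have hlim : Tendsto σ L (𝓝 ν) := hν
  refine ⟨L, ν, hL, inferInstance, fun ξ => ?_, fun E hE h => ?_⟩
  · let f : BoundedContinuousFunction ℝ ℂ := BoundedContinuousFunction.ofNormedAddCommGroup
      (fun x : ℝ => Complex.exp (-2 * Real.pi * Complex.I * x * ξ)) (by fun_prop) 1
      fun x => by simp [Complex.norm_exp]
    exact (FiniteMeasure.tendsto_iff_forall_integral_rclike_tendsto ℂ).1 hlim f
  · have hmem : ν ∈ X E := (hX hE).isClosed.mem_of_tendsto hlim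
      ((h.filter_mono hL).mono fun j hj => hσ hj)
    exact (FiniteMeasure.null_iff_toMeasure_null _ _).1 hmem.2

end WeakLimit

section Dimension

theorem hausdorffContent_norm_mul_le {d : ℝ} {p : ℕ} (hp : 0 < p) (η : ℝ) :
    hausdorffContent d {x ∈ Icc (0 : ℝ) 2 | ‖((p * x : ℝ) : UnitAddCircle)‖ ≤ η} ≤
      3 * p * ENNReal.ofReal (2 * (η / p)) ^ d := by
  have hp0 : (0 : ℝ) < p := Nat.cast_pos.2 hp
  have hcover : {x ∈ Icc (0 : ℝ) 2 | ‖((p * x : ℝ) : UnitAddCircle)‖ ≤ η} ⊆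
      ⋃ n ∈ Finset.Icc (0 : ℤ) (2 * p), Icc (n / p - η / p : ℝ) (n / p + η / p) := by
    rintro x ⟨⟨hx0, hx2⟩, hx⟩
    rw [UnitAddCircle.norm_eq] at hx
    obtain ⟨hlow, hupp⟩ := abs_le.1 hx
    obtain ⟨hlow', hupp'⟩ := abs_le.1 (abs_sub_round (p * x))
    have hn0 : (-1 : ℝ) < round (p * x) := by nlinarith
    have hn2 : (round (p * x) : ℝ) < 2 * p + 1 := by nlinarith
    refine mem_biUnion (x := round (p * x)) (Finset.mem_coe.2 (Finset.mem_Icc.2 ⟨?_, ?_⟩)) ⟨?_, ?_⟩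
    · exact Int.lt_iff_add_one_le.1 (by exact_mod_cast hn0)
    · exact Int.lt_add_one_iff.1 (by exact_mod_cast hn2)
    · rw [← sub_div, div_le_iff₀ hp0]
      linarith
    · rw [← add_div, le_div_iff₀ hp0]
      linarith
  calc _ ≤ ∑ n ∈ Finset.Icc (0 : ℤ) (2 * p),
        hausdorffContent d (Icc (n / p - η / p : ℝ) (n / p + η / p)) :=
        (measure_mono hcover).trans (measure_biUnion_finset_le _ _)
    _ ≤ ∑ _n ∈ Finset.Icc (0 : ℤ) (2 * p), ENNReal.ofReal (2 * (η / p)) ^ d := by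
        refine Finset.sum_le_sum fun n _ => (hausdorffContent_le_ediam_rpow d _).trans_eq ?_
        rw [Real.ediam_Icc]
        ring_nf
    _ ≤ _ := by
        rw [Finset.sum_const, nsmul_eq_mul, Int.card_Icc]
        gcongr
        norm_cast
        lia

theorem hausdorffContent_norm_mul_le_rpow (d : ℝ) {p : ℕ} (hp : 0 < p) {η : ℝ} (hη : 0 < η) :
    hausdorffContent d {x ∈ Icc (0 : ℝ) 2 | ‖((p * x : ℝ) : UnitAddCircle)‖ ≤ η} ≤
      ENNReal.ofReal (3 * (2 * η) ^ d * p ^ (1 - d)) := by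
  have hp0 : (0 : ℝ) < p := Nat.cast_pos.2 hp
  refine (hausdorffContent_norm_mul_le hp η).trans_eq ?_
  rw [ENNReal.ofReal_rpow_of_pos (by positivity), ← ENNReal.ofReal_natCast p,
    ← ENNReal.ofReal_ofNat 3, ← ENNReal.ofReal_mul (by positivity),
    ← ENNReal.ofReal_mul (by positivity), ← mul_div_assoc,
    Real.div_rpow (by positivity) hp0.le, Real.rpow_sub hp0, Real.rpow_one]
  ring_nf

theorem hausdorffContent_primeNeighborhood_le {d : ℝ} (hd : d ≤ 1) (M : ℕ) {η : ℝ} (hη : 0 < η) :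
    hausdorffContent d (Icc 0 2 ∩ primeNeighborhood M η) ≤
      ENNReal.ofReal (3 * (2 * η) ^ d * M ^ (2 - d)) := by
  rcases M.eq_zero_or_pos with rfl | hM
  · simp [primeNeighborhood]
  have hM0 : (0 : ℝ) < M := Nat.cast_pos.2 hM
  have hcover : Icc 0 2 ∩ primeNeighborhood M η ⊆ ⋃ p ∈ Nat.primesLE M,
      {x ∈ Icc (0 : ℝ) 2 | ‖((p * x : ℝ) : UnitAddCircle)‖ ≤ η} :=
    fun x ⟨hx, p, hp, hpx⟩ => mem_biUnion (Finset.mem_coe.2 hp) ⟨hx, hpx⟩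
  have hcard : (Nat.primesLE M).card ≤ M := by
    simpa using Finset.card_le_card (t := Finset.Icc 1 M) fun p hp => Finset.mem_Icc.2
      ⟨(Nat.prime_of_mem_primesLE hp).one_le, Nat.le_of_mem_primesLE hp⟩
  calc _ ≤ ∑ p ∈ Nat.primesLE M, hausdorffContent d
        {x ∈ Icc (0 : ℝ) 2 | ‖((p * x : ℝ) : UnitAddCircle)‖ ≤ η} :=
        (measure_mono hcover).trans (measure_biUnion_finset_le _ _)
    _ ≤ M * ENNReal.ofReal (3 * (2 * η) ^ d * M ^ (1 - d)) := by
        refine (Finset.sum_le_card_nsmul _ _ (ENNReal.ofReal (3 * (2 * η) ^ d * M ^ (1 - d)))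
          fun p hp => ?_).trans ?_
        · refine (hausdorffContent_norm_mul_le_rpow d (Nat.prime_of_mem_primesLE hp).pos
            hη).trans ?_
          gcongr
          exact Nat.le_of_mem_primesLE hp
        · rw [nsmul_eq_mul]
          gcongr
    _ = _ := by
        rw [← ENNReal.ofReal_natCast, ← ENNReal.ofReal_mul (by positivity),
          show 2 - d = 1 + (1 - d) by ring, Real.rpow_add hM0, Real.rpow_one]
        ring_nf

theorem tendsto_hausdorffContent_primeNeighborhood {α d : ℝ} (hα : 0 < α) (hd : α < d)
    (hd1 : d ≤ 1) :
    Tendsto (fun M : ℕ => hausdorffContent d (Icc 0 2 ∩ primeNeighborhood M (salemScale α M)))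
      atTop (𝓝 0) := by
  have hpos : 0 < 2 * d / α - 2 := by
    rw [sub_pos, lt_div_iff₀ hα]
    linarith
  have hlim : Tendsto (fun M : ℕ => ENNReal.ofReal (3 * 2 ^ d * (M : ℝ) ^ (2 - 2 * d / α))) atTop
      (𝓝 0) := by
    simpa only [neg_sub, mul_zero, ENNReal.ofReal_zero, Function.comp_def] using
      ENNReal.tendsto_ofReal (((tendsto_rpow_neg_atTop hpos).comp
        tendsto_natCast_atTop_atTop).const_mul (3 * 2 ^ d))
  refine tendsto_of_tendsto_of_tendsto_of_le_of_le' tendsto_const_nhds hlim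
    (Eventually.of_forall fun _ => zero_le) ?_
  filter_upwards [eventually_gt_atTop 0] with M hM
  have hM0 : (0 : ℝ) < M := Nat.cast_pos.2 hM
  refine (hausdorffContent_primeNeighborhood_le hd1 M (salemScale_pos α hM)).trans_eq ?_
  rw [Real.mul_rpow two_pos.le (salemScale_pos α hM).le, salemScale, ← Real.rpow_mul hM0.le,
    ← mul_assoc, mul_assoc (3 * 2 ^ d), ← Real.rpow_add hM0]
  ring_nf

theorem dimH_le_of_subset_primeNeighborhood {α : ℝ} (hα0 : 0 < α) {M : ℕ → ℕ}
    (hM : Tendsto M atTop atTop) {C : Set ℝ} (hC : C ⊆ Icc 0 2)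
    (hCM : ∀ j, C ⊆ primeNeighborhood (M j) (salemScale α (M j))) :
    dimH C ≤ ENNReal.ofReal α := by
  by_contra! hlt
  obtain ⟨d, hαd, hdC⟩ := ENNReal.lt_iff_exists_nnreal_btwn.1 hlt
  have hd : α < d := by
    simpa using (ENNReal.ofReal_lt_iff_lt_toReal hα0.le ENNReal.coe_ne_top).1 hαd
  have hd1 : (d : ℝ) ≤ 1 := by
    have h : (d : ℝ≥0∞) ≤ 1 := hdC.le.trans ((dimH_mono (subset_univ C)).trans_eq Real.dimH_univ)
    exact_mod_cast h
  have hcontent : hausdorffContent d C = 0 := le_antisymm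
    (ge_of_tendsto' ((tendsto_hausdorffContent_primeNeighborhood hα0 hd hd1).comp hM) fun j =>
      measure_mono (subset_inter hC (hCM j))) zero_le
  have hmeasure := hausdorffMeasure_eq_zero_of_hausdorffContent_eq_zero (hα0.trans hd) hcontent
  simp [hausdorffMeasure_of_lt_dimH hdC] at hmeasure

end Dimension

section SalemSet

/-- The compact subset of `[0, 2]` cut out by the prime neighbourhoods of the levels `M j`: the
Salem set of dimension `α` when `M j` grows fast enough. -/
def sieveSet (α : ℝ) (M : ℕ → ℕ) : Set ℝ :=
  Icc 0 2 ∩ ⋂ j, primeNeighborhood (M j) (salemScale α (M j))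

theorem isCompact_sieveSet (α : ℝ) (M : ℕ → ℕ) : IsCompact (sieveSet α M) :=
  isCompact_Icc.inter_right (isClosed_iInter fun _ => isClosed_primeNeighborhood _ _)

theorem dimH_sieveSet_le {α : ℝ} (hα : 0 < α) {M : ℕ → ℕ} (hM : Tendsto M atTop atTop) :
    dimH (sieveSet α M) ≤ ENNReal.ofReal α :=
  dimH_le_of_subset_primeNeighborhood hα hM inter_subset_left fun j =>
    inter_subset_right.trans (iInter_subset _ j)

theorem hasFourierDecay_of_enorm_measureFourier_le {ν : Measure ℝ} {C : ℝ≥0∞} (hC : C ≠ ∞) {β : ℝ}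
    (hβ : 0 ≤ β) (h : ∀ ξ, ‖measureFourier ν ξ‖ₑ ≤ C * (1 + ‖ξ‖ₑ) ^ (-β)) :
    HasFourierDecay ν (2 * β) := by
  refine ⟨C.toReal ^ 2, ?_⟩
  rintro _ ⟨ξ, rfl⟩
  have hC' : ‖measureFourier ν ξ‖ₑ * ‖ξ‖ₑ ^ β ≤ C :=
    calc _ ≤ C * (1 + ‖ξ‖ₑ) ^ (-β) * (1 + ‖ξ‖ₑ) ^ β := by
          gcongr
          exacts [h ξ, le_add_self]
      _ = C := by
          rw [mul_assoc, ← ENNReal.rpow_add _ _ (by simp) (by simp), neg_add_cancel,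
            ENNReal.rpow_zero, mul_one]
  have hreal : ‖measureFourier ν ξ‖ * |ξ| ^ β ≤ C.toReal := by
    simpa [← ENNReal.toReal_rpow] using ENNReal.toReal_mono hC hC'
  calc ‖measureFourier ν ξ‖ ^ 2 * |ξ| ^ (2 * β) = (‖measureFourier ν ξ‖ * |ξ| ^ β) ^ 2 := by
        rw [mul_pow, ← Real.rpow_mul_natCast (abs_nonneg ξ), mul_comm β, Nat.cast_ofNat]
    _ ≤ C.toReal ^ 2 := by gcongr

namespace IsSieveSequence

variable {α : ℝ} {γ : ℕ → ℝ} {ε : ℕ → ℝ≥0∞} {ρ : ℕ → Measure ℝ} {M : ℕ → ℕ}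

theorem measure_inter_primeNeighborhood_compl (h : IsSieveSequence α γ ε ρ M) {i j : ℕ}
    (hij : i < j) : ρ j (Icc 0 2 ∩ primeNeighborhood (M i) (salemScale α (M i)))ᶜ = 0 := by
  rw [compl_inter]
  exact measure_union_null (h.isSievable j).measure_compl
    (h.absolutelyContinuous hij (h.measure_compl_succ i))

theorem enorm_measureFourier_le (h : IsSieveSequence α γ ε ρ M) {β : ℝ} (hβ2 : β ≤ 1 / 2)
    {i j : ℕ} (hβ : ∀ k ≥ i, β ≤ γ k) (hij : i ≤ j) (ξ : ℝ) :
    ‖measureFourier (ρ j) ξ‖ₑ ≤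
      (∑' k, ε k + latticeFourierNorm (1 / 2) (ρ i)) * (1 + ‖ξ‖ₑ) ^ (-β) := by
  have hi : ‖measureFourier (ρ i) ξ‖ₑ ≤ latticeFourierNorm (1 / 2) (ρ i) * (1 + ‖ξ‖ₑ) ^ (-β) := by
    rw [ENNReal.rpow_neg, ← div_eq_mul_inv,
      ENNReal.le_div_iff_mul_le (Or.inl (by simp)) (Or.inl (by simp)), mul_comm]
    exact (rpow_mul_enorm_measureFourier_le β (ρ i) ξ).trans (latticeFourierNorm_mono hβ2 _)
  calc ‖measureFourier (ρ j) ξ‖ₑ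
      ≤ ‖measureFourier (ρ j) ξ - measureFourier (ρ i) ξ‖ₑ + ‖measureFourier (ρ i) ξ‖ₑ := by
        simpa using enorm_add_le (measureFourier (ρ j) ξ - measureFourier (ρ i) ξ)
          (measureFourier (ρ i) ξ)
    _ ≤ _ := by
        rw [add_mul, ← edist_eq_enorm_sub, edist_comm]
        exact add_le_add (h.edist_measureFourier_le hβ hij ξ) hi

theorem edist_one_measureFourier_zero_le (h : IsSieveSequence α γ ε ρ M) (hγ : ∀ k, 0 ≤ γ k)
    (j : ℕ) : edist 1 (measureFourier (ρ j) 0) ≤ ∑' k, ε k := by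
  have := h.isProbabilityMeasure_zero
  simpa [measureFourier_zero] using
    h.edist_measureFourier_le (fun k _ => hγ k) (Nat.zero_le j) 0

theorem measure_univ_le_two (h : IsSieveSequence α γ ε ρ M) (hγ : ∀ k, 0 ≤ γ k)
    (hε : ∑' k, ε k ≤ 1) (j : ℕ) : ρ j univ ≤ 2 := by
  have := (h.isSievable j).isFiniteMeasure
  calc ρ j univ = edist (measureFourier (ρ j) 0) 0 := by
        rw [measureFourier_zero, edist_zero_right, ← ofReal_norm, Complex.norm_real,
          Real.norm_of_nonneg measureReal_nonneg, ofReal_measureReal]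
    _ ≤ edist (measureFourier (ρ j) 0) 1 + edist 1 0 := edist_triangle _ _ _
    _ ≤ 1 + 1 := by
        rw [edist_comm _ (1 : ℂ)]
        gcongr
        exacts [(h.edist_one_measureFourier_zero_le hγ j).trans hε, by simp]
    _ = 2 := one_add_one_eq_two

theorem exists_limit (h : IsSieveSequence α γ ε ρ M) (hγ : ∀ k, 0 ≤ γ k) (hε : ∑' k, ε k < 1) :
    ∃ (L : Ultrafilter ℕ) (ν : Measure ℝ), (L : Filter ℕ) ≤ atTop ∧
      ν ∈ compactlySupportedMeasures (sieveSet α M) ∧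
      ∀ ξ, Tendsto (fun j => measureFourier (ρ j) ξ) L (𝓝 (measureFourier ν ξ)) := by
  have (j : ℕ) := (h.isSievable j).isFiniteMeasure
  obtain ⟨L, ν, hL, hfin, hlim, hnull⟩ := exists_tendsto_measureFourier isCompact_Icc
    (h.measure_univ_le_two hγ hε.le) fun j => (h.isSievable j).measure_compl
  refine ⟨L, ν, hL, mem_compactlySupportedMeasures (isCompact_sieveSet α M) ?_ ?_, hlim⟩
  · rintro rfl
    have hdist : edist 1 (measureFourier 0 0) ≤ ∑' k, ε k :=
      le_of_tendsto' (tendsto_const_nhds.edist (hlim 0)) (h.edist_one_measureFourier_zero_le hγ)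
    exact (hdist.trans_lt hε).ne (by simp [measureFourier_zero])
  · rw [sieveSet, inter_iInter, compl_iInter]
    refine measure_iUnion_null fun j => hnull _
      (isCompact_Icc.inter_right (isClosed_primeNeighborhood _ _)) ?_
    exact (eventually_gt_atTop j).mono fun i hi => h.measure_inter_primeNeighborhood_compl hi

theorem hasFourierDecay_limit (h : IsSieveSequence α γ ε ρ M) (hε : ∑' k, ε k ≠ ∞)
    {L : Filter ℕ} [L.NeBot] (hL : L ≤ atTop) {ν : Measure ℝ}
    (hlim : ∀ ξ, Tendsto (fun j => measureFourier (ρ j) ξ) L (𝓝 (measureFourier ν ξ))) {β : ℝ}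
    (hβ0 : 0 ≤ β) (hβ2 : β ≤ 1 / 2) (hβ : ∀ᶠ k in atTop, β ≤ γ k) :
    HasFourierDecay ν (2 * β) := by
  obtain ⟨i, hi⟩ := eventually_atTop.1 hβ
  refine hasFourierDecay_of_enorm_measureFourier_le
    (ENNReal.add_ne_top.2 ⟨hε, (h.isSievable i).latticeFourierNorm_lt_top.ne⟩) hβ0 fun ξ => ?_
  exact le_of_tendsto (hlim ξ).enorm (((eventually_ge_atTop i).filter_mono hL).mono fun j hj =>
    h.enorm_measureFourier_le hβ2 hi hj ξ)

end IsSieveSequence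

theorem ofReal_le_fourierDim {A : Set ℝ} {α : ℝ} (hα : α ≤ 1) {μ : Measure ℝ}
    (hμ : μ ∈ compactlySupportedMeasures A)
    (h : ∀ s : ℝ, 0 ≤ s → s < α → HasFourierDecay μ s) : ENNReal.ofReal α ≤ fourierDim A := by
  refine ENNReal.le_of_forall_nnreal_lt fun t ht => ?_
  have htα : (t : ℝ) < α := by
    rwa [← ENNReal.ofReal_coe_nnreal, ENNReal.ofReal_lt_ofReal_iff_of_nonneg t.coe_nonneg] at ht
  exact le_iSup₂_of_le (f := fun (s : ℝ≥0) (_ : s ≤ 1 ∧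
    ∃ μ ∈ compactlySupportedMeasures A, HasFourierDecay μ s) => (s : ℝ≥0∞)) t
    ⟨by exact_mod_cast (htα.le.trans hα), μ, hμ, h t t.coe_nonneg htα⟩ le_rfl

theorem exists_sieveSet_ofReal_le_fourierDim {α : ℝ} (hα0 : 0 < α) (hα1 : α ≤ 1) :
    ∃ M : ℕ → ℕ, Tendsto M atTop atTop ∧ ENNReal.ofReal α ≤ fourierDim (sieveSet α M) := by
  obtain ⟨γ, -, hγ, hγlim⟩ := exists_seq_strictMono_tendsto' (half_pos hα0)
  have hγ0 (j : ℕ) : 0 ≤ γ j := (hγ j).1.le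
  obtain ⟨ε, hε0, hε⟩ := ENNReal.exists_pos_sum_of_countable one_ne_zero ℕ
  obtain ⟨ρ, M, h⟩ := exists_isSieveSequence hα0 hα1 hγ0 (fun j => (hγ j).2)
    fun j => ENNReal.coe_pos.2 (hε0 j)
  obtain ⟨L, ν, hL, hν, hlim⟩ := h.exists_limit hγ0 hε
  refine ⟨M, tendsto_atTop_mono h.le_level tendsto_id,
    ofReal_le_fourierDim hα1 hν fun s hs0 hs => ?_⟩
  have hdecay := h.hasFourierDecay_limit (hε.trans ENNReal.one_lt_top).ne hL hlim (by positivity)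
    (by linarith) (hγlim.eventually_const_le (by linarith : s / 2 < α / 2))
  rwa [mul_div_cancel₀ s two_ne_zero] at hdecay

theorem nonempty_of_fourierDim_pos {A : Set ℝ} (h : 0 < fourierDim A) : A.Nonempty := by
  rw [nonempty_iff_ne_empty]
  rintro rfl
  exact (h.trans_le (fourierDim_le_dimH ∅)).ne' dimH_empty

theorem exists_salem_set {α : ℝ} (hα : α ∈ Icc (0 : ℝ) 1) :
    ∃ C : Set ℝ, IsCompact C ∧ C ⊆ Icc 0 2 ∧ C.Nonempty ∧ dimH C ≤ ENNReal.ofReal α ∧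
      ENNReal.ofReal α ≤ fourierDim C := by
  rcases hα.1.eq_or_lt with rfl | hα0
  · exact ⟨{0}, isCompact_singleton, by simp, singleton_nonempty 0, by simp, by simp⟩
  · obtain ⟨M, hM, hF⟩ := exists_sieveSet_ofReal_le_fourierDim hα0 hα.2
    exact ⟨sieveSet α M, isCompact_sieveSet α M, inter_subset_left,
      nonempty_of_fourierDim_pos ((ENNReal.ofReal_pos.2 hα0).trans_le hF),
      dimH_sieveSet_le hα0 hM, hF⟩

end SalemSet

section AffineImage

theorem norm_measureFourier_map_affine (μ : Measure ℝ) (a b ξ : ℝ) :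
    ‖measureFourier (μ.map fun c => a + b * c) ξ‖ = ‖measureFourier μ (b * ξ)‖ := by
  have hmap : μ.map (fun c => a + b * c) = (μ.map (b * ·)).map (a + ·) :=
    (Measure.map_map (by fun_prop) (by fun_prop)).symm
  rw [measureFourier_eq_charFun, measureFourier_eq_charFun, hmap, charFun_map_const_add,
    charFun_map_mul, norm_mul, Complex.norm_exp_ofReal_mul_I, mul_one, mul_left_comm]

theorem HasFourierDecay.map_affine {μ : Measure ℝ} {s : ℝ} (h : HasFourierDecay μ s) (a : ℝ) {b : ℝ}
    (hb : 0 < b) : HasFourierDecay (μ.map fun c => a + b * c) s := by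
  obtain ⟨C, hC⟩ := h
  refine ⟨C / b ^ s, ?_⟩
  rintro _ ⟨ξ, rfl⟩
  simp only [norm_measureFourier_map_affine]
  rw [le_div_iff₀ (by positivity), mul_assoc, ← Real.mul_rpow (abs_nonneg ξ) hb.le, mul_comm |ξ|,
    ← abs_of_pos hb, ← abs_mul, abs_of_pos hb]
  exact hC ⟨b * ξ, rfl⟩

theorem map_mem_compactlySupportedMeasures {μ : Measure ℝ} {A : Set ℝ}
    (hμ : μ ∈ compactlySupportedMeasures A) {f : ℝ → ℝ} (hf : Continuous f) :
    μ.map f ∈ compactlySupportedMeasures (f '' A) := by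
  obtain ⟨hμf, hμ0, hμK, hμA⟩ := hμ
  have hK := hμK.image hf
  refine compactlySupportedMeasures_mono (image_mono hμA) (mem_compactlySupportedMeasures hK
    ((Measure.map_ne_zero_iff hf.aemeasurable).2 hμ0) ?_)
  rw [Measure.map_apply hf.measurable hK.measurableSet.compl]
  exact measure_mono_null (fun x hx hxs => hx (mem_image_of_mem _ hxs))
    Measure.measure_compl_support

theorem fourierDim_le_fourierDim_image_affine (A : Set ℝ) (a : ℝ) {b : ℝ} (hb : 0 < b) :
    fourierDim A ≤ fourierDim ((fun c => a + b * c) '' A) :=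
  iSup₂_mono' fun s ⟨hs1, _, hμ, hdecay⟩ =>
    ⟨s, ⟨hs1, _, map_mem_compactlySupportedMeasures hμ (by fun_prop), hdecay.map_affine a hb⟩,
      le_rfl⟩

theorem dimH_image_affine_le (A : Set ℝ) (a b : ℝ) :
    dimH ((fun c => a + b * c) '' A) ≤ dimH A := by
  have hlip : LipschitzWith ‖b‖₊ fun c : ℝ => a + b * c :=
    LipschitzWith.of_dist_le_mul fun x y => by
      rw [dist_add_left, Real.dist_eq, Real.dist_eq, ← mul_sub, abs_mul, coe_nnnorm,
        Real.norm_eq_abs]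
  exact hlip.dimH_image_le A

end AffineImage

section Main

theorem exists_nnreal_lt_add {x a b : ℝ≥0∞} (h : x < a + b) :
    ∃ s : ℝ≥0, (s = 0 ∨ s < a) ∧ x < s + b := by
  rcases eq_zero_or_pos a with rfl | ha
  · exact ⟨0, Or.inl rfl, by simpa using h⟩
  · have := nhdsLT_neBot_of_exists_lt ⟨0, ha⟩
    have hlim : Tendsto (· + b) (𝓝[<] a) (𝓝 (a + b)) :=
      ((continuous_add_const b).tendsto a).mono_left nhdsWithin_le_nhds
    obtain ⟨s, hs, hsa⟩ := ((hlim.eventually_const_lt h).and self_mem_nhdsWithin).exists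
    lift s to ℝ≥0 using hsa.ne_top
    exact ⟨s, Or.inr hsa, hs⟩

theorem supportsCorrelationDecay_of_eq_zero_or_lt_fourierDim {A : Set ℝ} (hA : A.Nonempty)
    {s : ℝ≥0} (hs : s = 0 ∨ s < fourierDim A) : SupportsCorrelationDecay A s := by
  rcases hs with rfl | hs
  · exact supportsCorrelationDecay_zero hA
  · exact supportsCorrelationDecay_of_lt_fourierDim hs

theorem supportsCorrelationDecay_of_eq_zero_or_lt_dimH {Z : Set ℝ} (hZ : IsClosed Z)
    (hne : Z.Nonempty) {s : ℝ≥0} (hs : s = 0 ∨ s < dimH Z) : SupportsCorrelationDecay Z s := by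
  rcases eq_or_ne s 0 with rfl | hs0
  · exact supportsCorrelationDecay_zero hne
  · exact supportsCorrelationDecay_of_lt_dimH hZ (pos_iff_ne_zero.2 hs0) (hs.resolve_left hs0)

theorem supportsCorrelationDecay_diff_zero {Y : Set ℝ} (hY : ∃ y ∈ Y, y ≠ 0) {s : ℝ≥0}
    (hs : s = 0 ∨ s < fourierDim Y) : SupportsCorrelationDecay (Y \ {0}) s := by
  rcases eq_or_ne s 0 with rfl | hs0
  · exact supportsCorrelationDecay_zero hY
  · exact (supportsCorrelationDecay_of_lt_fourierDim (hs.resolve_left hs0)).diff_singleton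
      (NNReal.coe_pos.2 (pos_iff_ne_zero.2 hs0)) 0

theorem exists_affine_volume_pos_of_one_lt_add {C Y Z : Set ℝ} (hC : C.Nonempty)
    (hY : ∃ y ∈ Y, y ≠ 0) (hZ : IsClosed Z) (hZne : Z.Nonempty)
    (h : 1 < fourierDim C + (fourierDim Y + dimH Z)) :
    ∃ a ∈ Icc (1 : ℝ) 2, ∃ b ∈ Icc (1 : ℝ) 2, 0 < volume ((fun c => a + b * c) '' C * Y + Z) := by
  obtain ⟨s₁, hs₁, h⟩ := exists_nnreal_lt_add h
  obtain ⟨s₂, hs₂, h⟩ := exists_nnreal_lt_add (h.trans_eq (add_left_comm _ _ _))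
  obtain ⟨s₃, hs₃, h⟩ := exists_nnreal_lt_add (h.trans_eq ((add_assoc _ _ _).symm.trans
    (add_comm _ _)))
  have hs : (1 : ℝ) < s₁ + s₂ + s₃ := by
    have hsum : 1 < s₃ + (s₂ + s₁) := by exact_mod_cast h
    rw [add_comm (s₁ : ℝ), add_comm]
    exact_mod_cast hsum
  obtain ⟨a, ha, b, hb, hvol⟩ := exists_affine_volume_pos (by simp)
    (supportsCorrelationDecay_of_eq_zero_or_lt_fourierDim hC hs₁)
    (supportsCorrelationDecay_diff_zero hY hs₂)
    (supportsCorrelationDecay_of_eq_zero_or_lt_dimH hZ hZne hs₃) hs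
  exact ⟨a, ha, b, hb, hvol.trans_le (measure_mono
    (add_subset_add_right (mul_subset_mul_left sdiff_subset)))⟩

theorem mainTheorem5_general {Y Z : Set ℝ} (hZ : IsClosed Z) (hZne : Z.Nonempty)
    (hY0 : ∃ y ∈ Y, y ≠ 0) {α : ℝ} (hα : α ∈ Icc (0 : ℝ) 1)
    (hdim : ENNReal.ofReal (1 - α) < fourierDim Y + dimH Z) :
    ∃ R : Set ℝ, IsCompact R ∧ R ⊆ Ioi 0 ∧
      dimH R = ENNReal.ofReal α ∧ fourierDim R = ENNReal.ofReal α ∧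
      0 < volume (R * Y + Z) := by
  obtain ⟨C, hC, hC2, hCne, hCdim, hCF⟩ := exists_salem_set hα
  have hsum : 1 < fourierDim C + (fourierDim Y + dimH Z) :=
    calc (1 : ℝ≥0∞) = ENNReal.ofReal α + ENNReal.ofReal (1 - α) := by
          rw [← ENNReal.ofReal_add hα.1 (sub_nonneg.2 hα.2), add_sub_cancel, ENNReal.ofReal_one]
      _ < ENNReal.ofReal α + (fourierDim Y + dimH Z) :=
          ENNReal.add_lt_add_left ENNReal.ofReal_ne_top hdim
      _ ≤ _ := by gcongr
  obtain ⟨a, ha, b, hb, hvol⟩ := exists_affine_volume_pos_of_one_lt_add hCne hY0 hZ hZne hsum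
  have hb0 : 0 < b := zero_lt_one.trans_le hb.1
  have hRdim := (dimH_image_affine_le C a b).trans hCdim
  have hRF := hCF.trans (fourierDim_le_fourierDim_image_affine C a hb0)
  have hle := fourierDim_le_dimH ((fun c => a + b * c) '' C)
  refine ⟨(fun c => a + b * c) '' C, hC.image (by fun_prop), ?_, hRdim.antisymm (hRF.trans hle),
    (hle.trans hRdim).antisymm hRF, hvol⟩
  rintro _ ⟨c, hc, rfl⟩
  exact add_pos_of_pos_of_nonneg (zero_lt_one.trans_le ha.1) (mul_nonneg hb0.le (hC2 hc).1)

end Main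

theorem mainTheorem5 (Y Z : Set ℝ) (hY : IsCompact Y) (hZ : IsCompact Z)
    (hZne : Z.Nonempty) (hY0 : ∃ y ∈ Y, y ≠ 0)
    (hpos : 0 < fourierDim Y + dimH Z) (α : ℝ) (hα : α ∈ Icc (0 : ℝ) 1)
    (hdim : ENNReal.ofReal (1 - α) < fourierDim Y + dimH Z) :
    ∃ R : Set ℝ, IsCompact R ∧ R ⊆ Ioi 0 ∧
      dimH R = ENNReal.ofReal α ∧ fourierDim R = ENNReal.ofReal α ∧
      0 < volume (R * Y + Z) :=
  mainTheorem5_general hZ.isClosed hZne hY0 hα hdim
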